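/- **Syntax.** The setting is the synchronous $\pi$-calculus with de Bruijn indices. A context is a natural number $\Gamma$, whose names are $0,\dots,\Gamma-1$. Processes over $\Gamma$ are $$P ::= 0 \mid \underline{x}.P' \mid \overline{x}\langle y\rangle.P \mid P+Q \mid P\mid Q \mid \nu P' \mid\ !P,$$ where $x,y$ are names of $\Gamma$ and $P'$ (under an input or $\nu$) is a process over $\Gamma+1$. A renaming $\rho:\Gamma\to\Delta$ acts on processes, actions and transition derivations by $\rho^*$, and lifts to $\rho+1:\Gamma+1\to\Delta+1$ ($0\mapsto 0$, $x+1\mapsto\rho(x)+1$), hence to $\rho+n$. Let $\mathrm{push}(x)=x+1$; $\mathrm{pop}_y(0)=y$, $\mathrm{pop}_y(x+1)=x$; and let $\mathrm{swap}$ exchange $0$ and $1$. **Transitions.** Actions over $\Gamma$ are bound, $b::=\underline{x}\mid\overline{x}$ (input, bound output; $|b|=1$), or non-bound, $c::=\overline{x}\langle y\rangle\mid\tau$ ($|c|=0$); the target context of $a$ is $\Gamma+|a|$. Transitions $t:P\xrightarrow{a}R$ are the derivations generated by the following rules, where $t:P\to R$ and $u:Q\to S$: * $\underline{x}.P\xrightarrow{\underline{x}}P$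 and $\overline{x}\langle y\rangle.P\xrightarrow{\overline{x}\langle y\rangle}P$; * $t+Q$ and $P+u$ (choice); * $t\mid Q: P\mid Q\xrightarrow{a} R\mid(\mathrm{push}^{|a|})^*Q$ and $P\mid u:P\mid Q\xrightarrow{a}(\mathrm{push}^{|a|})^*P\mid S$; * synchronisation: $P\mid Q\xrightarrow{\tau}\mathrm{pop}_y^*R\mid S$ from $t$ with action $\underline{x}$ and $u$ with action $\overline{x}\langle y\rangle$, and its mirror image; * $\nu$-synchronisation: $P\mid Q\xrightarrow{\tau}\nu(R\mid S)$ from $t$ with $\underline{x}$ and $u$ with $\overline{x}$, and its mirror image; * extrusion $\bar\nu t:\nu P\xrightarrow{\overline{x}}R$ from $t:P\xrightarrow{\overline{x+1}\langle0\rangle}R$; * propagation through a binder: $\nu_b t:\nu P\xrightarrow{b}\nu(\mathrm{swap}^*R)$ from $t:P\xrightarrow{\mathrm{push}^*b}R$, and $\nu_c t:\nu P\xrightarrow{c}\nu R$ from $t:P\xrightarrow{\mathrm{push}^*c}R$; * $!t:\ !P\xrightarrow{a}R$ from $t:P\mid{!P}\xrightarrow{a}R$. **Concurrency and residuals.** Derivations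 of $t\smile t'$ are defined, for coinitial $t:P\xrightarrow{a}R$ and $t':P\xrightarrow{a'}R'$, simultaneously with residuals $t'/t$ (from $R$, action $a'/a$) and $t/t'$ (from $R'$, action $a/a'$). Each derivation has one of these types: (i) non-bound/non-bound, residual actions $c',c$; (ii) bound/non-bound in either order, where $c/b=\mathrm{push}^*c$ and $b/c=b$; (iii) bound/bound, residual actions $\mathrm{push}^*b',\mathrm{push}^*b$; (iv) extrusions $\overline{x},\overline{y}$ of the same binder, residual actions $\overline{y+1}\langle0\rangle$ and $\overline{x+1}\langle0\rangle$; (v) $\tau,\tau$, two $\nu$-synchronisations of distinct binders, residual actions $\tau,\tau$. The relation is the symmetric closure of the rules below together with their left/right mirror images; types are (i)–(iii) according to the actions unless stated. * $P\mid u\smile t\mid Q$, with residuals $(\mathrm{push}^{|u|})^*t\mid S$ and $R\mid(\mathrm{push}^{|t|})^*u$ (here $|t|$ is the size of the action of $t$). * If $t\smile t'$, then $t+Q\smile t'+Q$ (residuals $t'/t,\ t/t'$), $t\mid Q\smile t'\mid Q$ (residuals $t'/t\mid(\mathrm{push}^{|a|})^*Q$ and $t/t'\mid(\mathrm{push}^{|a'|})^*Q$)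 and, for $t,t'$ out of $P\mid{!P}$, $!t\smile{!t'}$ (residuals $t'/t,\ t/t'$); the type is that of $t\smile t'$. * If $t\smile t'$ and a synchronisation or $\nu$-synchronisation of $t'$ with $u$ gives $s'$, then $t\mid Q\smile s'$. The residual $s'/(t\mid Q)$ is the synchronisation of the same kind of $t'/t$ with $(\mathrm{push}^{|a|})^*u$. The residual $(t\mid Q)/s'$ is $\mathrm{pop}_y^*(t/t')\mid S$ if $t'$ is the input of a synchronisation with message $y$; $(t/t')\mid\mathrm{pop}_y^*S$ if $t'$ is its output; and $\nu_a\big((t/t')\mid S\big)$ for a $\nu$-synchronisation. Exception: if $t\smile t'$ has type (iv), the residuals are the plain synchronisation (message $0$) of $t'/t$ with $\mathrm{push}^*u$, and $\bar\nu\big((t/t')\mid S\big)$. * If $t\smile t'$ and $u\smile u'$, with $s$ a ($\nu$-)synchronisation of $t,u$ and $s'$ one of $t',u'$, then $s\smile s'$. The residual $s'/s$ is built from $t'/t$ and $u'/u$ by a synchronisation of the kind of $s'$, after applying $\mathrm{pop}_y^*$ to the residual on the receiving side of $s$ if $s$ is a plain synchronisation with message $y$, and under $\nu_\tau$ if $s$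 is a $\nu$-synchronisation; $s/s'$ is symmetric. The type is (v) if both are $\nu$-synchronisations and the output premises do not have type (iv). If the output premises have type (iv), the type is (i) and the residual synchronisations under $\nu_\tau$ are plain, with message $0$. * Under a binder, if $t\smile t'$: $\bar\nu t\smile\bar\nu t'$ (type (iv); residuals $t'/t,\ t/t'$); $\bar\nu t\smile\nu_{b}t'$ (residuals $t'/t,\ \bar\nu(\mathrm{swap}^*(t/t'))$); $\bar\nu t\smile\nu_{c}t'$ (residuals $t'/t,\ \bar\nu(t/t')$); $\nu_bt\smile\nu_{b'}t'$ (residuals $\nu(\mathrm{swap}^*(t'/t)),\ \nu(\mathrm{swap}^*(t/t'))$, type preserved); $\nu_bt\smile\nu_ct'$ (residuals $\nu_c(\mathrm{swap}^*(t'/t)),\ \nu_b(t/t')$); $\nu_ct\smile\nu_{c'}t'$ (residuals $\nu_{c'}(t'/t),\ \nu_c(t/t')$, type preserved). **Braidings.** A *free braid* between $P,R$ over $\Gamma+2$ is an equation $P=\mathrm{swap}^*R$. A *bound braid* transposes one pair of adjacent binders: it relates $\nu\nu P$ to $\nu\nu R$ when $P=\mathrm{swap}^*R$, closed under $\_+Q$,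 $P+\_$, $\_\mid Q$, $P\mid\_$, $\nu\_$, $!\_$. For $t\smile t'$ there is a canonical braiding $\gamma_{t,t'}$ from $\mathrm{target}(t'/t)$ to $\mathrm{target}(t/t')$, constructed by recursion on $t\smile t'$: a free braid in type (iii), an equality in types (i), (ii), (iv), a bound braid in type (v). *Generalised bound braids* are generated by the same transposition rule, reflexivity on $0$ and on prefixed processes, congruence in one argument of $+$, in both arguments of $\mid$ simultaneously, and under $\nu$ and $!$. The *generalised braiding relation* at depth $\Delta$ is $P=(\mathrm{swap}+\Delta)^*R$ in type (iii) and generalised bound braids in the other types; $\gamma_{t,t'}$ embeds at $\Delta=0$. A transition $t:P\xrightarrow{a}R$ and a generalised braiding $\gamma$ from $P$ to $P'$ have residuals $t/\gamma$ from $P'$ to some $R'$, and $\gamma/t$ from $R$ to $R'$, at depth $\Delta+|a|$. For a free braid, $t/\gamma=(\mathrm{swap}+\Delta)^*t$ and $R=(\mathrm{swap}+\Delta+|a|)^*R'$. For a bound braid $\varphi$ they are defined by recursion on $t$ and $\varphi$: reflexive residual on prefixes; $(t+Q)/(\varphi+Q)=t/\varphi+Q$ with $\varphi/t$; $(t+Q)/(P+\psi)=t+Q'$,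 where $\psi$ relates $Q$ to $Q'$, with reflexive residual; mirror images; $(t\mid Q)/(\varphi\mid\psi)=t/\varphi\mid Q'$ with $\varphi/t\mid(\mathrm{push}^{|a|})^*\psi$; ($\nu$-)synchronisations componentwise, with $\mathrm{pop}_y^*$ applied to, respectively $\nu$ wrapped around, the residual braids; $\bar\nu t/\nu\varphi=\bar\nu(t/\varphi)$ with $\varphi/t$; $\nu_bt/\nu\varphi=\nu_b(t/\varphi)$ with $\nu(\mathrm{swap}^*(\varphi/t))$; $\nu_ct/\nu\varphi=\nu_c(t/\varphi)$ with $\nu(\varphi/t)$; $!t/!\varphi={!(t/(\varphi\mid{!\varphi}))}$ with $(\varphi\mid{!\varphi})/t$. For the transposition $\varphi:\nu\nu P\to\nu\nu P'$: $\nu_c\nu_ct\mapsto\nu_c\nu_c(\mathrm{swap}^*t)$ and $\nu_b\nu_bt\mapsto\nu_b\nu_b(\mathrm{swap}^*t)$, with a transposition as residual; $\bar\nu\nu_ct\mapsto\nu_b\bar\nu(\mathrm{swap}^*t)$ and $\nu_b\bar\nu t\mapsto\bar\nu\nu_c(\mathrm{swap}^*t)$, with reflexive residual. **Traces and causal equivalence.**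 A trace $\vec t$ is a finite composable sequence of transitions: $\varepsilon_P$ or $t\cdot\vec t$. Residuals extend to traces by $\varepsilon/\gamma=\varepsilon$, $\gamma/\varepsilon=\gamma$, $(t\cdot\vec t)/\gamma=(t/\gamma)\cdot(\vec t/(\gamma/t))$, $\gamma/(t\cdot\vec t)=(\gamma/t)/\vec t$. Causal equivalences $\alpha:\vec t\simeq\vec u$ are the derivations generated by $$\varepsilon_P\simeq\varepsilon_P,\qquad \frac{\alpha:\vec t\simeq\vec u}{t\cdot\alpha:\ t\cdot\vec t\simeq t\cdot\vec u},\qquad \frac{t\smile t'}{[t,t'],\vec t:\ t\cdot t'/t\cdot\vec t\simeq t'\cdot t/t'\cdot\vec t/\gamma_{t,t'}},\qquad \frac{\alpha:\vec t'\simeq\vec u\quad\beta:\vec t\simeq\vec t'}{\alpha\circ\beta:\ \vec t\simeq\vec u}.$$ **Composite braidings.** For each $\alpha:\vec t\simeq\vec u$, the composite braidings $P\ltimes_\alpha R$ are the derivations generated by: $P\ltimes_{\varepsilon_P}P$; $\ P\ltimes_{[t,t'],\vec t}R$ whenever the transported braiding $\gamma_{t,t'}/\vec t$ relates $P$ to $R$;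 $\ P\ltimes_{t\cdot\alpha}R$ from $P\ltimes_\alpha R$; $\ P\ltimes_{\alpha\circ\beta}S$ from $P\ltimes_\beta R$ and $R\ltimes_\alpha S$, for any intermediate process $R$. **Theorem.** Suppose $\alpha:\vec t\simeq\vec u$. Then there exists exactly one $\gamma_\alpha:\mathrm{target}(\vec t)\ltimes_\alpha\mathrm{target}(\vec u)$. -/

import Mathlib

namespace PiCalculus

/-! ### Processes, renamings and actions -/

/-- `Proc Γ` is the set of processes closed by the context `Γ` (a natural number); the names in
scope are the de Bruijn indices `0, …, Γ - 1`. -/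
inductive Proc : ℕ → Type
  | nil {Γ : ℕ} : Proc Γ
  | inp {Γ : ℕ} (x : Fin Γ) (P : Proc (Γ + 1)) : Proc Γ
  | out {Γ : ℕ} (x y : Fin Γ) (P : Proc Γ) : Proc Γ
  | choice {Γ : ℕ} (P Q : Proc Γ) : Proc Γ
  | par {Γ : ℕ} (P Q : Proc Γ) : Proc Γ
  | nu {Γ : ℕ} (P : Proc (Γ + 1)) : Proc Γ
  | repl {Γ : ℕ} (P : Proc Γ) : Proc Γ

/-- The renaming `push`: `x ↦ x + 1`. -/
def push {Γ : ℕ} (x : Fin Γ) : Fin (Γ + 1) := x.succ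

/-- The renaming `pop y`: `0 ↦ y`, `x + 1 ↦ x`. -/
def pop {Γ : ℕ} (y : Fin Γ) (x : Fin (Γ + 1)) : Fin Γ :=
  Fin.cases y (fun x => x) x

/-- The renaming `swap`: `0 ↦ 1`, `1 ↦ 0`, `x + 2 ↦ x + 2`. -/
def swap {Γ : ℕ} (x : Fin (Γ + 2)) : Fin (Γ + 2) :=
  Fin.cases 1 (fun x => Fin.cases 0 (fun x => x.succ.succ) x) x

/-- The lifting `ρ + 1` of a renaming: `0 ↦ 0`, `x + 1 ↦ ρ x + 1`. -/
def lift {Γ Δ : ℕ} (ρ : Fin Γ → Fin Δ) (x : Fin (Γ + 1)) : Fin (Δ + 1) :=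
  Fin.cases 0 (fun x => (ρ x).succ) x

/-- The iterated lifting `ρ + n` of a renaming. -/
def liftN {Γ Δ : ℕ} (ρ : Fin Γ → Fin Δ) : (n : ℕ) → Fin (Γ + n) → Fin (Δ + n)
  | 0 => ρ
  | n + 1 => lift (liftN ρ n)

/-- The functorial action of a renaming on processes. -/
def Proc.ren : {Γ Δ : ℕ} → (Fin Γ → Fin Δ) → Proc Γ → Proc Δ
  | _, _, _, .nil => .nil
  | _, _, ρ, .inp x P => .inp (ρ x) (P.ren (lift ρ))
  | _, _, ρ, .out x y P => .out (ρ x) (ρ y) (P.ren ρ)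
  | _, _, ρ, .choice P Q => .choice (P.ren ρ) (Q.ren ρ)
  | _, _, ρ, .par P Q => .par (P.ren ρ) (Q.ren ρ)
  | _, _, ρ, .nu P => .nu (P.ren (lift ρ))
  | _, _, ρ, .repl P => .repl (P.ren ρ)

/-- Bound actions `b`: inputs and bound outputs. -/
inductive BAct (Γ : ℕ) : Type
  | inp (x : Fin Γ) : BAct Γ
  | bout (x : Fin Γ) : BAct Γ

/-- Non-bound actions `c`: (free) outputs and the silent action. -/
inductive CAct (Γ : ℕ) : Type
  | out (x y : Fin Γ) : CAct Γ
  | tau : CAct Γ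

def BAct.ren {Γ Δ : ℕ} (ρ : Fin Γ → Fin Δ) : BAct Γ → BAct Δ
  | .inp x => .inp (ρ x)
  | .bout x => .bout (ρ x)

def CAct.ren {Γ Δ : ℕ} (ρ : Fin Γ → Fin Δ) : CAct Γ → CAct Δ
  | .out x y => .out (ρ x) (ρ y)
  | .tau => .tau

/-- `Act Γ Γ'` is the set of actions `a` in context `Γ` whose target context `Γ + |a|` is `Γ'`:
a bound action has target context `Γ + 1`, a non-bound action has target context `Γ`. -/
inductive Act : ℕ → ℕ → Type
  | b {Γ : ℕ} (b : BAct Γ) : Act Γ (Γ + 1)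
  | c {Γ : ℕ} (c : CAct Γ) : Act Γ Γ

/-- The amount `|a|` by which an action increments the context. -/
def Act.size : {Γ Γ' : ℕ} → Act Γ Γ' → ℕ
  | _, _, .b _ => 1
  | _, _, .c _ => 0

/-- The process `Q` moved to the target context of the action: `push* Q` for a bound action,
`Q` itself for a non-bound one. -/
def Act.push : {Γ Γ' : ℕ} → Act Γ Γ' → Proc Γ → Proc Γ'
  | _, _, .b _, Q => Q.ren PiCalculus.push
  | _, _, .c _, Q => Q

@[simp] theorem push_apply {Γ : ℕ} (x : Fin Γ) : push x = x.succ := rfl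
@[simp] theorem pop_zero {Γ : ℕ} (y : Fin Γ) : pop y 0 = y := rfl
@[simp] theorem pop_succ {Γ : ℕ} (y x : Fin Γ) : pop y x.succ = x := rfl
@[simp] theorem swap_zero {Γ : ℕ} : swap (0 : Fin (Γ + 2)) = Fin.succ 0 := rfl
@[simp] theorem swap_one {Γ : ℕ} : swap (Fin.succ 0 : Fin (Γ + 2)) = 0 := rfl
@[simp] theorem swap_succ {Γ : ℕ} (x : Fin Γ) : swap x.succ.succ = x.succ.succ := rfl
@[simp] theorem lift_zero {Γ Δ : ℕ} (ρ : Fin Γ → Fin Δ) : lift ρ 0 = 0 := rfl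
@[simp] theorem lift_succ {Γ Δ : ℕ} (ρ : Fin Γ → Fin Δ) (x : Fin Γ) :
    lift ρ x.succ = (ρ x).succ := rfl

theorem lift_comp {Γ Δ Θ : ℕ} (σ : Fin Δ → Fin Θ) (ρ : Fin Γ → Fin Δ) :
    lift σ ∘ lift ρ = lift (σ ∘ ρ) := by
  funext i; refine Fin.cases rfl (fun i => rfl) i

theorem lift_id {Γ : ℕ} : lift (id : Fin Γ → Fin Γ) = id := by
  funext i; refine Fin.cases rfl (fun i => rfl) i

theorem Proc.ren_ren {Γ Δ Θ : ℕ} (σ : Fin Δ → Fin Θ) (ρ : Fin Γ → Fin Δ) (P : Proc Γ) :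
    (P.ren ρ).ren σ = P.ren (σ ∘ ρ) := by
  induction P generalizing Δ Θ <;> simp_all [Proc.ren, lift_comp]

theorem Proc.ren_id {Γ : ℕ} (P : Proc Γ) : P.ren id = P := by
  induction P <;> simp_all [Proc.ren, lift_id]

theorem BAct.ren_ren {Γ Δ Θ : ℕ} (σ : Fin Δ → Fin Θ) (ρ : Fin Γ → Fin Δ) (b : BAct Γ) :
    (b.ren ρ).ren σ = b.ren (σ ∘ ρ) := by
  cases b <;> rfl

theorem CAct.ren_ren {Γ Δ Θ : ℕ} (σ : Fin Δ → Fin Θ) (ρ : Fin Γ → Fin Δ) (c : CAct Γ) :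
    (c.ren ρ).ren σ = c.ren (σ ∘ ρ) := by
  cases c <;> rfl

theorem pop_push {Γ : ℕ} (y : Fin Γ) : pop y ∘ push = id := rfl

theorem lift_push {Γ Δ : ℕ} (ρ : Fin Γ → Fin Δ) : lift ρ ∘ push = push ∘ ρ := rfl

theorem pop_lift {Γ Δ : ℕ} (ρ : Fin Γ → Fin Δ) (y : Fin Γ) :
    ρ ∘ pop y = pop (ρ y) ∘ lift ρ := by
  funext i; refine Fin.cases rfl (fun i => rfl) i

theorem swap_lift {Γ Δ : ℕ} (ρ : Fin Γ → Fin Δ) :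
    lift (lift ρ) ∘ swap = swap ∘ lift (lift ρ) := by
  funext i; refine Fin.cases rfl (fun i => Fin.cases rfl (fun i => rfl) i) i

theorem swap_swap {Γ : ℕ} : (swap ∘ swap : Fin (Γ + 2) → Fin (Γ + 2)) = id := by
  funext i; refine Fin.cases rfl (fun i => Fin.cases rfl (fun i => rfl) i) i

theorem swap_push_push {Γ : ℕ} :
    (swap ∘ push ∘ push : Fin Γ → Fin (Γ + 2)) = push ∘ push := rfl

/-! ### Transitions -/

/-- Labelled transitions `P —a→ R` as a data type of derivations. Premises of the form
`P —push* a→ R` and `P —(x+1)⟨0⟩→ R` are written with an explicit equation for the action. -/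
inductive Trans : {Γ Γ' : ℕ} → Proc Γ → Act Γ Γ' → Proc Γ' → Type
  | inp {Γ : ℕ} (x : Fin Γ) (P : Proc (Γ + 1)) : Trans (.inp x P) (.b (.inp x)) P
  | out {Γ : ℕ} (x y : Fin Γ) (P : Proc Γ) : Trans (.out x y P) (.c (.out x y)) P
  | choiceL {Γ Γ' : ℕ} {P : Proc Γ} {a : Act Γ Γ'} {R : Proc Γ'} (t : Trans P a R) (Q : Proc Γ) :
      Trans (.choice P Q) a R
  | choiceR {Γ Γ' : ℕ} (P : Proc Γ) {Q : Proc Γ} {a : Act Γ Γ'} {S : Proc Γ'} (u : Trans Q a S) :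
      Trans (.choice P Q) a S
  | parL {Γ Γ' : ℕ} {P : Proc Γ} {a : Act Γ Γ'} {R : Proc Γ'} (t : Trans P a R) (Q : Proc Γ) :
      Trans (.par P Q) a (.par R (a.push Q))
  | parR {Γ Γ' : ℕ} (P : Proc Γ) {Q : Proc Γ} {a : Act Γ Γ'} {S : Proc Γ'} (u : Trans Q a S) :
      Trans (.par P Q) a (.par (a.push P) S)
  | tauL {Γ : ℕ} {P Q : Proc Γ} {x y : Fin Γ} {R : Proc (Γ + 1)} {S : Proc Γ}
      (t : Trans P (.b (.inp x)) R) (u : Trans Q (.c (.out x y)) S) :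
      Trans (.par P Q) (.c .tau) (.par (R.ren (pop y)) S)
  | tauR {Γ : ℕ} {P Q : Proc Γ} {x y : Fin Γ} {R : Proc Γ} {S : Proc (Γ + 1)}
      (t : Trans P (.c (.out x y)) R) (u : Trans Q (.b (.inp x)) S) :
      Trans (.par P Q) (.c .tau) (.par R (S.ren (pop y)))
  | nuL {Γ : ℕ} {P Q : Proc Γ} {x : Fin Γ} {R S : Proc (Γ + 1)}
      (t : Trans P (.b (.inp x)) R) (u : Trans Q (.b (.bout x)) S) :
      Trans (.par P Q) (.c .tau) (.nu (.par R S))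
  | nuR {Γ : ℕ} {P Q : Proc Γ} {x : Fin Γ} {R S : Proc (Γ + 1)}
      (t : Trans P (.b (.bout x)) R) (u : Trans Q (.b (.inp x)) S) :
      Trans (.par P Q) (.c .tau) (.nu (.par R S))
  | extr {Γ : ℕ} {P R : Proc (Γ + 1)} {x : Fin Γ} {c : CAct (Γ + 1)}
      (h : c = .out x.succ 0) (t : Trans P (.c c) R) :
      Trans (.nu P) (.b (.bout x)) R
  | nuB {Γ : ℕ} {P : Proc (Γ + 1)} {R : Proc (Γ + 2)} {b : BAct Γ} {b₁ : BAct (Γ + 1)}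
      (h : b₁ = b.ren push) (t : Trans P (.b b₁) R) :
      Trans (.nu P) (.b b) (.nu (R.ren swap))
  | nuC {Γ : ℕ} {P R : Proc (Γ + 1)} {c : CAct Γ} {c₁ : CAct (Γ + 1)}
      (h : c₁ = c.ren push) (t : Trans P (.c c₁) R) :
      Trans (.nu P) (.c c) (.nu R)
  | repl {Γ Γ' : ℕ} {P : Proc Γ} {a : Act Γ Γ'} {R : Proc Γ'}
      (t : Trans (.par P (.repl P)) a R) :
      Trans (.repl P) a R

/-- Transport of a transition with bound action along equations. -/
def Trans.castB {Γ : ℕ} {P P' : Proc Γ} {b b' : BAct Γ} {R R' : Proc (Γ + 1)}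
    (t : Trans P (.b b) R) (hP : P = P') (hb : b = b') (hR : R = R') : Trans P' (.b b') R' :=
  hP ▸ hb ▸ hR ▸ t

/-- Transport of a transition with non-bound action along equations. -/
def Trans.castC {Γ : ℕ} {P P' : Proc Γ} {c c' : CAct Γ} {R R' : Proc Γ}
    (t : Trans P (.c c) R) (hP : P = P') (hc : c = c') (hR : R = R') : Trans P' (.c c') R' :=
  hP ▸ hc ▸ hR ▸ t

/-- The type of `ρ* t` for `t : P —a→ R`. -/
def Trans.RenTy {Γ Δ : ℕ} (ρ : Fin Γ → Fin Δ) (P : Proc Γ) : {Γ' : ℕ} → Act Γ Γ' → Proc Γ' → Type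
  | _, .b b, R => Trans (P.ren ρ) (.b (b.ren ρ)) (R.ren (lift ρ))
  | _, .c c, R => Trans (P.ren ρ) (.c (c.ren ρ)) (R.ren ρ)

theorem Proc.lift_push_ren {Γ Δ : ℕ} (ρ : Fin Γ → Fin Δ) (Q : Proc Γ) :
    (Q.ren ρ).ren push = (Q.ren push).ren (lift ρ) := by
  rw [Proc.ren_ren, Proc.ren_ren, lift_push]

theorem Proc.pop_lift_ren {Γ Δ : ℕ} (ρ : Fin Γ → Fin Δ) (y : Fin Γ) (R : Proc (Γ + 1)) :
    (R.ren (lift ρ)).ren (pop (ρ y)) = (R.ren (pop y)).ren ρ := by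
  rw [Proc.ren_ren, Proc.ren_ren, pop_lift]

theorem Proc.swap_lift_ren {Γ Δ : ℕ} (ρ : Fin Γ → Fin Δ) (R : Proc (Γ + 2)) :
    (R.ren (lift (lift ρ))).ren swap = (R.ren swap).ren (lift (lift ρ)) := by
  rw [Proc.ren_ren, Proc.ren_ren, swap_lift]

theorem BAct.lift_push_ren {Γ Δ : ℕ} (ρ : Fin Γ → Fin Δ) (b : BAct Γ) :
    (b.ren push).ren (lift ρ) = (b.ren ρ).ren push := by
  cases b <;> rfl

theorem CAct.lift_push_ren {Γ Δ : ℕ} (ρ : Fin Γ → Fin Δ) (c : CAct Γ) :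
    (c.ren push).ren (lift ρ) = (c.ren ρ).ren push := by
  cases c <;> rfl

/-- The renaming `ρ* t` of a transition. -/
def Trans.renAux : {Γ Γ' Δ : ℕ} → (ρ : Fin Γ → Fin Δ) → {P : Proc Γ} → {a : Act Γ Γ'} →
    {R : Proc Γ'} → Trans P a R → Trans.RenTy ρ P a R
  | _, _, _, ρ, _, _, _, .inp x P => .inp (ρ x) (P.ren (lift ρ))
  | _, _, _, ρ, _, _, _, .out x y P => .out (ρ x) (ρ y) (P.ren ρ)
  | _, _, _, ρ, _, .b _, _, .choiceL t Q => .choiceL (t.renAux ρ) (Q.ren ρ)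
  | _, _, _, ρ, _, .c _, _, .choiceL t Q => .choiceL (t.renAux ρ) (Q.ren ρ)
  | _, _, _, ρ, _, .b _, _, .choiceR P u => .choiceR (P.ren ρ) (u.renAux ρ)
  | _, _, _, ρ, _, .c _, _, .choiceR P u => .choiceR (P.ren ρ) (u.renAux ρ)
  | _, _, _, ρ, _, .b _, _, .parL t Q =>
      Trans.castB (.parL (t.renAux ρ) (Q.ren ρ)) rfl rfl
        (congrArg (Proc.par _) (Q.lift_push_ren ρ))
  | _, _, _, ρ, _, .c _, _, .parL t Q => .parL (t.renAux ρ) (Q.ren ρ)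
  | _, _, _, ρ, _, .b _, _, .parR P u =>
      Trans.castB (.parR (P.ren ρ) (u.renAux ρ)) rfl rfl
        (congrArg (fun X => Proc.par X _) (P.lift_push_ren ρ))
  | _, _, _, ρ, _, .c _, _, .parR P u => .parR (P.ren ρ) (u.renAux ρ)
  | _, _, _, ρ, _, _, _, .tauL (y := y) (R := R) t u =>
      Trans.castC (.tauL (t.renAux ρ) (u.renAux ρ)) rfl rfl
        (congrArg (fun X => Proc.par X _) (R.pop_lift_ren ρ y))
  | _, _, _, ρ, _, _, _, .tauR (y := y) (S := S) t u =>
      Trans.castC (.tauR (t.renAux ρ) (u.renAux ρ)) rfl rfl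
        (congrArg (Proc.par _) (S.pop_lift_ren ρ y))
  | _, _, _, ρ, _, _, _, .nuL t u => .nuL (t.renAux ρ) (u.renAux ρ)
  | _, _, _, ρ, _, _, _, .nuR t u => .nuR (t.renAux ρ) (u.renAux ρ)
  | _, _, _, ρ, _, _, _, .extr h t => .extr (by subst h; rfl) (t.renAux (lift ρ))
  | _, _, _, ρ, _, _, _, .nuB (R := R) h t =>
      Trans.castB (.nuB (by subst h; exact BAct.lift_push_ren _ _) (t.renAux (lift ρ))) rfl rfl
        (congrArg Proc.nu (R.swap_lift_ren ρ))
  | _, _, _, ρ, _, _, _, .nuC h t =>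
      .nuC (by subst h; exact CAct.lift_push_ren _ _) (t.renAux (lift ρ))
  | _, _, _, ρ, _, .b _, _, .repl t => .repl (t.renAux ρ)
  | _, _, _, ρ, _, .c _, _, .repl t => .repl (t.renAux ρ)

/-- `ρ* t` for a transition with bound action. -/
def Trans.renB {Γ Δ : ℕ} {P : Proc Γ} {b : BAct Γ} {R : Proc (Γ + 1)} (t : Trans P (.b b) R)
    (ρ : Fin Γ → Fin Δ) : Trans (P.ren ρ) (.b (b.ren ρ)) (R.ren (lift ρ)) :=
  t.renAux ρ

/-- `ρ* t` for a transition with non-bound action. -/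
def Trans.renC {Γ Δ : ℕ} {P : Proc Γ} {c : CAct Γ} {R : Proc Γ} (t : Trans P (.c c) R)
    (ρ : Fin Γ → Fin Δ) : Trans (P.ren ρ) (.c (c.ren ρ)) (R.ren ρ) :=
  t.renAux ρ

/-! ### Braids -/

/-- Free braid. -/
def FreeBraid {Γ : ℕ} (P R : Proc (Γ + 2)) : Prop := P = R.ren swap

/-- Bound braid: exactly one pair of adjacent binders is transposed. -/
inductive BoundBraid₁ : {Γ : ℕ} → Proc Γ → Proc Γ → Type
  | swap {Γ : ℕ} {P R : Proc (Γ + 2)} (h : FreeBraid P R) : BoundBraid₁ (.nu (.nu P)) (.nu (.nu R))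
  | choiceL {Γ : ℕ} {P R : Proc Γ} (φ : BoundBraid₁ P R) (Q : Proc Γ) :
      BoundBraid₁ (.choice P Q) (.choice R Q)
  | choiceR {Γ : ℕ} (P : Proc Γ) {Q S : Proc Γ} (ψ : BoundBraid₁ Q S) :
      BoundBraid₁ (.choice P Q) (.choice P S)
  | parL {Γ : ℕ} {P R : Proc Γ} (φ : BoundBraid₁ P R) (Q : Proc Γ) :
      BoundBraid₁ (.par P Q) (.par R Q)
  | parR {Γ : ℕ} (P : Proc Γ) {Q S : Proc Γ} (ψ : BoundBraid₁ Q S) :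
      BoundBraid₁ (.par P Q) (.par P S)
  | nu {Γ : ℕ} {P R : Proc (Γ + 1)} (φ : BoundBraid₁ P R) : BoundBraid₁ (.nu P) (.nu R)
  | repl {Γ : ℕ} {P R : Proc Γ} (φ : BoundBraid₁ P R) : BoundBraid₁ (.repl P) (.repl R)

/-- Generalised bound braid, which can be dropped or duplicated. -/
inductive BoundBraid : {Γ : ℕ} → Proc Γ → Proc Γ → Type
  | swap {Γ : ℕ} {P R : Proc (Γ + 2)} (h : FreeBraid P R) : BoundBraid (.nu (.nu P)) (.nu (.nu R))
  | nil {Γ : ℕ} : BoundBraid (.nil : Proc Γ) .nil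
  | inp {Γ : ℕ} (x : Fin Γ) (P : Proc (Γ + 1)) : BoundBraid (.inp x P) (.inp x P)
  | out {Γ : ℕ} (x y : Fin Γ) (P : Proc Γ) : BoundBraid (.out x y P) (.out x y P)
  | choiceL {Γ : ℕ} {P R : Proc Γ} (φ : BoundBraid P R) (Q : Proc Γ) :
      BoundBraid (.choice P Q) (.choice R Q)
  | choiceR {Γ : ℕ} (P : Proc Γ) {Q S : Proc Γ} (ψ : BoundBraid Q S) :
      BoundBraid (.choice P Q) (.choice P S)
  | par {Γ : ℕ} {P R Q S : Proc Γ} (φ : BoundBraid P R) (ψ : BoundBraid Q S) :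
      BoundBraid (.par P Q) (.par R S)
  | nu {Γ : ℕ} {P R : Proc (Γ + 1)} (φ : BoundBraid P R) : BoundBraid (.nu P) (.nu R)
  | repl {Γ : ℕ} {P R : Proc Γ} (φ : BoundBraid P R) : BoundBraid (.repl P) (.repl R)

theorem Proc.swap_swap {Γ : ℕ} (P : Proc (Γ + 2)) : (P.ren swap).ren swap = P := by
  rw [Proc.ren_ren, PiCalculus.swap_swap, Proc.ren_id]

theorem FreeBraid.symm {Γ : ℕ} {P R : Proc (Γ + 2)} (h : FreeBraid P R) : FreeBraid R P := by
  unfold FreeBraid at *; rw [h, Proc.swap_swap]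

/-- Symmetry of bound braids. -/
def BoundBraid₁.symm : {Γ : ℕ} → {P R : Proc Γ} → BoundBraid₁ P R → BoundBraid₁ R P
  | _, _, _, .swap h => .swap h.symm
  | _, _, _, .choiceL φ Q => .choiceL φ.symm Q
  | _, _, _, .choiceR P ψ => .choiceR P ψ.symm
  | _, _, _, .parL φ Q => .parL φ.symm Q
  | _, _, _, .parR P ψ => .parR P ψ.symm
  | _, _, _, .nu φ => .nu φ.symm
  | _, _, _, .repl φ => .repl φ.symm

/-- Reflexivity of generalised bound braids. -/
def BoundBraid.refl : {Γ : ℕ} → (P : Proc Γ) → BoundBraid P P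
  | _, .nil => .nil
  | _, .inp x P => .inp x P
  | _, .out x y P => .out x y P
  | _, .choice P Q => .choiceL (BoundBraid.refl P) Q
  | _, .par P Q => .par (BoundBraid.refl P) (BoundBraid.refl Q)
  | _, .nu P => .nu (BoundBraid.refl P)
  | _, .repl P => .repl (BoundBraid.refl P)

/-- A generalised bound braid from an equality of processes. -/
def BoundBraid.ofEq {Γ : ℕ} {P R : Proc Γ} (h : P = R) : BoundBraid P R := h ▸ BoundBraid.refl P

/-- The embedding of bound braids into generalised bound braids. -/
def BoundBraid₁.embed : {Γ : ℕ} → {P R : Proc Γ} → BoundBraid₁ P R → BoundBraid P R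
  | _, _, _, .swap h => .swap h
  | _, _, _, .choiceL φ Q => .choiceL φ.embed Q
  | _, _, _, .choiceR P ψ => .choiceR P ψ.embed
  | _, _, _, .parL φ Q => .par φ.embed (.refl Q)
  | _, _, _, .parR P ψ => .par (.refl P) ψ.embed
  | _, _, _, .nu φ => .nu φ.embed
  | _, _, _, .repl φ => .repl φ.embed

/-! ### Concurrent actions -/

/-- Concurrent actions `a ⌣ a'` together with the residual actions `a'/a` and `a/a'` (in this
order) and the common target context. The constructors: two non-bound actions; a bound and a
non-bound action (in either order); two bound actions; two extrusions of the same binder; two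
`ν`-synchronisations of distinct binders. -/
inductive ActConc : {Γ Γ₁ Γ₂ Γ' : ℕ} → Act Γ Γ₁ → Act Γ Γ₂ → Act Γ₁ Γ' → Act Γ₂ Γ' → Type
  | cc {Γ : ℕ} (c c' : CAct Γ) : ActConc (.c c) (.c c') (.c c') (.c c)
  | bc {Γ : ℕ} (b : BAct Γ) (c : CAct Γ) : ActConc (.b b) (.c c) (.c (c.ren push)) (.b b)
  | cb {Γ : ℕ} (c : CAct Γ) (b : BAct Γ) : ActConc (.c c) (.b b) (.b b) (.c (c.ren push))
  | bb {Γ : ℕ} (b b' : BAct Γ) : ActConc (.b b) (.b b') (.b (b'.ren push)) (.b (b.ren push))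
  | ext {Γ : ℕ} (x y : Fin Γ) :
      ActConc (.b (.bout x)) (.b (.bout y)) (.c (.out y.succ 0)) (.c (.out x.succ 0))
  | nunu {Γ : ℕ} : ActConc (.c (.tau : CAct Γ)) (.c .tau) (.c .tau) (.c .tau)

/-- Symmetry of concurrent actions. -/
def ActConc.symm : {Γ Γ₁ Γ₂ Γ' : ℕ} → {a : Act Γ Γ₁} → {a' : Act Γ Γ₂} → {r : Act Γ₁ Γ'} →
    {r' : Act Γ₂ Γ'} → ActConc a a' r r' → ActConc a' a r' r
  | _, _, _, _, _, _, _, _, .cc c c' => .cc c' c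
  | _, _, _, _, _, _, _, _, .bc b c => .cb c b
  | _, _, _, _, _, _, _, _, .cb c b => .bc b c
  | _, _, _, _, _, _, _, _, .bb b b' => .bb b' b
  | _, _, _, _, _, _, _, _, .ext x y => .ext y x
  | _, _, _, _, _, _, _, _, .nunu => .nunu

/-- The braiding relation determined by concurrent actions. -/
def ActConc.Braiding : {Γ Γ₁ Γ₂ Γ' : ℕ} → {a : Act Γ Γ₁} → {a' : Act Γ Γ₂} → {r : Act Γ₁ Γ'} →
    {r' : Act Γ₂ Γ'} → ActConc a a' r r' → Proc Γ' → Proc Γ' → Type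
  | _, _, _, _, _, _, _, _, .cc _ _, P, R => PLift (P = R)
  | _, _, _, _, _, _, _, _, .bc _ _, P, R => PLift (P = R)
  | _, _, _, _, _, _, _, _, .cb _ _, P, R => PLift (P = R)
  | _, _, _, _, _, _, _, _, .bb _ _, P, R => PLift (FreeBraid P R)
  | _, _, _, _, _, _, _, _, .ext _ _, P, R => PLift (P = R)
  | _, _, _, _, _, _, _, _, .nunu, P, R => BoundBraid₁ P R

/-- Symmetry of the braiding relation. -/
def ActConc.braidingSymm : {Γ Γ₁ Γ₂ Γ' : ℕ} → {a : Act Γ Γ₁} → {a' : Act Γ Γ₂} → {r : Act Γ₁ Γ'} →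
    {r' : Act Γ₂ Γ'} → (s : ActConc a a' r r') → {P R : Proc Γ'} → s.Braiding P R →
    s.symm.Braiding R P
  | _, _, _, _, _, _, _, _, .cc _ _, _, _, γ => ⟨γ.down.symm⟩
  | _, _, _, _, _, _, _, _, .bc _ _, _, _, γ => ⟨γ.down.symm⟩
  | _, _, _, _, _, _, _, _, .cb _ _, _, _, γ => ⟨γ.down.symm⟩
  | _, _, _, _, _, _, _, _, .bb _ _, _, _, γ => ⟨γ.down.symm⟩
  | _, _, _, _, _, _, _, _, .ext _ _, _, _, γ => ⟨γ.down.symm⟩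
  | _, _, _, _, _, _, _, _, .nunu, _, _, γ => BoundBraid₁.symm γ

theorem Proc.swap_push_push {Γ : ℕ} (X : Proc Γ) :
    ((X.ren push).ren push).ren swap = (X.ren push).ren push := by
  simp only [Proc.ren_ren]; rfl

/-- The braiding relation is preserved by a parallel component that takes no part. -/
def ActConc.braidingParL : {Γ Γ₁ Γ₂ Γ' : ℕ} → {a : Act Γ Γ₁} → {a' : Act Γ Γ₂} → {r : Act Γ₁ Γ'} →
    {r' : Act Γ₂ Γ'} → (s : ActConc a a' r r') → {P R : Proc Γ'} → s.Braiding P R →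
    (X : Proc Γ) → s.Braiding (.par P (r.push (a.push X))) (.par R (r'.push (a'.push X)))
  | _, _, _, _, _, _, _, _, .cc _ _, _, _, γ, X => ⟨by rw [γ.down]; rfl⟩
  | _, _, _, _, _, _, _, _, .bc _ _, _, _, γ, X => ⟨by rw [γ.down]; rfl⟩
  | _, _, _, _, _, _, _, _, .cb _ _, _, _, γ, X => ⟨by rw [γ.down]; rfl⟩
  | _, _, _, _, _, _, _, _, .bb _ _, _, _, γ, X =>
      ⟨congrArg₂ Proc.par γ.down X.swap_push_push.symm⟩
  | _, _, _, _, _, _, _, _, .ext _ _, _, _, γ, X => ⟨by rw [γ.down]; rfl⟩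
  | _, _, _, _, _, _, _, _, .nunu, _, _, γ, X => .parL γ X

/-- The braiding relation is preserved by a parallel component that takes no part. -/
def ActConc.braidingParR : {Γ Γ₁ Γ₂ Γ' : ℕ} → {a : Act Γ Γ₁} → {a' : Act Γ Γ₂} → {r : Act Γ₁ Γ'} →
    {r' : Act Γ₂ Γ'} → (s : ActConc a a' r r') → {P R : Proc Γ'} → s.Braiding P R →
    (X : Proc Γ) → s.Braiding (.par (r.push (a.push X)) P) (.par (r'.push (a'.push X)) R)
  | _, _, _, _, _, _, _, _, .cc _ _, _, _, γ, X => ⟨by rw [γ.down]; rfl⟩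
  | _, _, _, _, _, _, _, _, .bc _ _, _, _, γ, X => ⟨by rw [γ.down]; rfl⟩
  | _, _, _, _, _, _, _, _, .cb _ _, _, _, γ, X => ⟨by rw [γ.down]; rfl⟩
  | _, _, _, _, _, _, _, _, .bb _ _, _, _, γ, X =>
      ⟨congrArg₂ Proc.par X.swap_push_push.symm γ.down⟩
  | _, _, _, _, _, _, _, _, .ext _ _, _, _, γ, X => ⟨by rw [γ.down]; rfl⟩
  | _, _, _, _, _, _, _, _, .nunu, _, _, γ, X => .parR X γ

/-! ### Concurrent transitions -/

/-- Concurrency `t ⌣ t'` of coinitial transitions, indexed by the concurrent actions. A rule for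
`t, t'` stands also for its mirror image `t', t` (constructor `symm`). -/
inductive Conc : {Γ Γ₁ Γ₂ Γ' : ℕ} → {a : Act Γ Γ₁} → {a' : Act Γ Γ₂} → {r : Act Γ₁ Γ'} →
    {r' : Act Γ₂ Γ'} → {P : Proc Γ} → {R : Proc Γ₁} → {R' : Proc Γ₂} →
    ActConc a a' r r' → Trans P a R → Trans P a' R' → Type
  | symm {Γ Γ₁ Γ₂ Γ' : ℕ} {a : Act Γ Γ₁} {a' : Act Γ Γ₂} {r : Act Γ₁ Γ'} {r' : Act Γ₂ Γ'}
      {P : Proc Γ} {R : Proc Γ₁} {R' : Proc Γ₂} {s : ActConc a a' r r'} {t : Trans P a R}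
      {t' : Trans P a' R'} (d : Conc s t t') : Conc s.symm t' t
  -- transitions on opposite sides of a parallel composition
  | parR_parL_bb {Γ : ℕ} {P Q : Proc Γ} {R S : Proc (Γ + 1)} {b b' : BAct Γ}
      (t : Trans P (.b b') R) (u : Trans Q (.b b) S) : Conc (.bb b b') (.parR P u) (.parL t Q)
  | parR_parL_bc {Γ : ℕ} {P Q : Proc Γ} {R : Proc Γ} {S : Proc (Γ + 1)} {b : BAct Γ} {c : CAct Γ}
      (t : Trans P (.c c) R) (u : Trans Q (.b b) S) : Conc (.bc b c) (.parR P u) (.parL t Q)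
  | parR_parL_cb {Γ : ℕ} {P Q : Proc Γ} {R : Proc (Γ + 1)} {S : Proc Γ} {b : BAct Γ} {c : CAct Γ}
      (t : Trans P (.b b) R) (u : Trans Q (.c c) S) : Conc (.cb c b) (.parR P u) (.parL t Q)
  | parR_parL_cc {Γ : ℕ} {P Q : Proc Γ} {R S : Proc Γ} {c c' : CAct Γ}
      (t : Trans P (.c c') R) (u : Trans Q (.c c) S) : Conc (.cc c c') (.parR P u) (.parL t Q)
  -- propagation on one side, synchronisation
  | parL_tauL_b {Γ : ℕ} {P Q : Proc Γ} {R R' : Proc (Γ + 1)} {S : Proc Γ} {b : BAct Γ} {x y : Fin Γ}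
      {t : Trans P (.b b) R} {t' : Trans P (.b (.inp x)) R'} (d : Conc (.bb b (.inp x)) t t')
      (u : Trans Q (.c (.out x y)) S) : Conc (.bc b .tau) (.parL t Q) (.tauL t' u)
  | parL_tauL_c {Γ : ℕ} {P Q : Proc Γ} {R : Proc Γ} {R' : Proc (Γ + 1)} {S : Proc Γ} {c : CAct Γ}
      {x y : Fin Γ} {t : Trans P (.c c) R} {t' : Trans P (.b (.inp x)) R'}
      (d : Conc (.cb c (.inp x)) t t') (u : Trans Q (.c (.out x y)) S) :
      Conc (.cc c .tau) (.parL t Q) (.tauL t' u)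
  | parL_tauR_b {Γ : ℕ} {P Q : Proc Γ} {R : Proc (Γ + 1)} {R' : Proc Γ} {S : Proc (Γ + 1)}
      {b : BAct Γ} {x y : Fin Γ} {t : Trans P (.b b) R} {t' : Trans P (.c (.out x y)) R'}
      (d : Conc (.bc b (.out x y)) t t') (u : Trans Q (.b (.inp x)) S) :
      Conc (.bc b .tau) (.parL t Q) (.tauR t' u)
  | parL_tauR_c {Γ : ℕ} {P Q : Proc Γ} {R R' : Proc Γ} {S : Proc (Γ + 1)} {c : CAct Γ} {x y : Fin Γ}
      {t : Trans P (.c c) R} {t' : Trans P (.c (.out x y)) R'} (d : Conc (.cc c (.out x y)) t t')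
      (u : Trans Q (.b (.inp x)) S) : Conc (.cc c .tau) (.parL t Q) (.tauR t' u)
  | parR_tauL_b {Γ : ℕ} {P Q : Proc Γ} {R : Proc (Γ + 1)} {S : Proc (Γ + 1)} {S' : Proc Γ}
      {b : BAct Γ} {x y : Fin Γ} {u : Trans Q (.b b) S} {u' : Trans Q (.c (.out x y)) S'}
      (t : Trans P (.b (.inp x)) R) (d : Conc (.bc b (.out x y)) u u') :
      Conc (.bc b .tau) (.parR P u) (.tauL t u')
  | parR_tauL_c {Γ : ℕ} {P Q : Proc Γ} {R : Proc (Γ + 1)} {S S' : Proc Γ} {c : CAct Γ} {x y : Fin Γ}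
      {u : Trans Q (.c c) S} {u' : Trans Q (.c (.out x y)) S'} (t : Trans P (.b (.inp x)) R)
      (d : Conc (.cc c (.out x y)) u u') : Conc (.cc c .tau) (.parR P u) (.tauL t u')
  | parR_tauR_b {Γ : ℕ} {P Q : Proc Γ} {R : Proc Γ} {S S' : Proc (Γ + 1)} {b : BAct Γ} {x y : Fin Γ}
      {u : Trans Q (.b b) S} {u' : Trans Q (.b (.inp x)) S'} (t : Trans P (.c (.out x y)) R)
      (d : Conc (.bb b (.inp x)) u u') : Conc (.bc b .tau) (.parR P u) (.tauR t u')
  | parR_tauR_c {Γ : ℕ} {P Q : Proc Γ} {R : Proc Γ} {S : Proc Γ} {S' : Proc (Γ + 1)} {c : CAct Γ}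
      {x y : Fin Γ} {u : Trans Q (.c c) S} {u' : Trans Q (.b (.inp x)) S'}
      (t : Trans P (.c (.out x y)) R) (d : Conc (.cb c (.inp x)) u u') :
      Conc (.cc c .tau) (.parR P u) (.tauR t u')
  -- propagation on one side, `ν`-synchronisation
  | parL_nuL_b {Γ : ℕ} {P Q : Proc Γ} {R R' : Proc (Γ + 1)} {S : Proc (Γ + 1)} {b : BAct Γ}
      {x : Fin Γ} {t : Trans P (.b b) R} {t' : Trans P (.b (.inp x)) R'}
      (d : Conc (.bb b (.inp x)) t t') (u : Trans Q (.b (.bout x)) S) :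
      Conc (.bc b .tau) (.parL t Q) (.nuL t' u)
  | parL_nuL_c {Γ : ℕ} {P Q : Proc Γ} {R : Proc Γ} {R' : Proc (Γ + 1)} {S : Proc (Γ + 1)}
      {c : CAct Γ} {x : Fin Γ} {t : Trans P (.c c) R} {t' : Trans P (.b (.inp x)) R'}
      (d : Conc (.cb c (.inp x)) t t') (u : Trans Q (.b (.bout x)) S) :
      Conc (.cc c .tau) (.parL t Q) (.nuL t' u)
  | parL_nuR_b {Γ : ℕ} {P Q : Proc Γ} {R R' : Proc (Γ + 1)} {S : Proc (Γ + 1)} {b : BAct Γ}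
      {x : Fin Γ} {t : Trans P (.b b) R} {t' : Trans P (.b (.bout x)) R'}
      (d : Conc (.bb b (.bout x)) t t') (u : Trans Q (.b (.inp x)) S) :
      Conc (.bc b .tau) (.parL t Q) (.nuR t' u)
  | parL_nuR_ext {Γ : ℕ} {P Q : Proc Γ} {R R' : Proc (Γ + 1)} {S : Proc (Γ + 1)} {z x : Fin Γ}
      {t : Trans P (.b (.bout z)) R} {t' : Trans P (.b (.bout x)) R'} (d : Conc (.ext z x) t t')
      (u : Trans Q (.b (.inp x)) S) : Conc (.bc (.bout z) .tau) (.parL t Q) (.nuR t' u)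
  | parL_nuR_c {Γ : ℕ} {P Q : Proc Γ} {R : Proc Γ} {R' : Proc (Γ + 1)} {S : Proc (Γ + 1)}
      {c : CAct Γ} {x : Fin Γ} {t : Trans P (.c c) R} {t' : Trans P (.b (.bout x)) R'}
      (d : Conc (.cb c (.bout x)) t t') (u : Trans Q (.b (.inp x)) S) :
      Conc (.cc c .tau) (.parL t Q) (.nuR t' u)
  | parR_nuL_b {Γ : ℕ} {P Q : Proc Γ} {R : Proc (Γ + 1)} {S S' : Proc (Γ + 1)} {b : BAct Γ}
      {x : Fin Γ} {u : Trans Q (.b b) S} {u' : Trans Q (.b (.bout x)) S'}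
      (t : Trans P (.b (.inp x)) R) (d : Conc (.bb b (.bout x)) u u') :
      Conc (.bc b .tau) (.parR P u) (.nuL t u')
  | parR_nuL_ext {Γ : ℕ} {P Q : Proc Γ} {R : Proc (Γ + 1)} {S S' : Proc (Γ + 1)} {z x : Fin Γ}
      {u : Trans Q (.b (.bout z)) S} {u' : Trans Q (.b (.bout x)) S'}
      (t : Trans P (.b (.inp x)) R) (d : Conc (.ext z x) u u') :
      Conc (.bc (.bout z) .tau) (.parR P u) (.nuL t u')
  | parR_nuL_c {Γ : ℕ} {P Q : Proc Γ} {R : Proc (Γ + 1)} {S : Proc Γ} {S' : Proc (Γ + 1)}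
      {c : CAct Γ} {x : Fin Γ} {u : Trans Q (.c c) S} {u' : Trans Q (.b (.bout x)) S'}
      (t : Trans P (.b (.inp x)) R) (d : Conc (.cb c (.bout x)) u u') :
      Conc (.cc c .tau) (.parR P u) (.nuL t u')
  | parR_nuR_b {Γ : ℕ} {P Q : Proc Γ} {R : Proc (Γ + 1)} {S S' : Proc (Γ + 1)} {b : BAct Γ}
      {x : Fin Γ} {u : Trans Q (.b b) S} {u' : Trans Q (.b (.inp x)) S'}
      (t : Trans P (.b (.bout x)) R) (d : Conc (.bb b (.inp x)) u u') :
      Conc (.bc b .tau) (.parR P u) (.nuR t u')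
  | parR_nuR_c {Γ : ℕ} {P Q : Proc Γ} {R : Proc (Γ + 1)} {S : Proc Γ} {S' : Proc (Γ + 1)}
      {c : CAct Γ} {x : Fin Γ} {u : Trans Q (.c c) S} {u' : Trans Q (.b (.inp x)) S'}
      (t : Trans P (.b (.bout x)) R) (d : Conc (.cb c (.inp x)) u u') :
      Conc (.cc c .tau) (.parR P u) (.nuR t u')
  -- propagation through choice and parallel composition on the same side
  | choiceL {Γ Γ₁ Γ₂ Γ' : ℕ} {a : Act Γ Γ₁} {a' : Act Γ Γ₂} {r : Act Γ₁ Γ'} {r' : Act Γ₂ Γ'}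
      {P : Proc Γ} {R : Proc Γ₁} {R' : Proc Γ₂} {s : ActConc a a' r r'} {t : Trans P a R}
      {t' : Trans P a' R'} (d : Conc s t t') (Q : Proc Γ) : Conc s (.choiceL t Q) (.choiceL t' Q)
  | choiceR {Γ Γ₁ Γ₂ Γ' : ℕ} {a : Act Γ Γ₁} {a' : Act Γ Γ₂} {r : Act Γ₁ Γ'} {r' : Act Γ₂ Γ'}
      (P : Proc Γ) {Q : Proc Γ} {S : Proc Γ₁} {S' : Proc Γ₂} {s : ActConc a a' r r'}
      {u : Trans Q a S} {u' : Trans Q a' S'} (d : Conc s u u') :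
      Conc s (.choiceR P u) (.choiceR P u')
  | parL {Γ Γ₁ Γ₂ Γ' : ℕ} {a : Act Γ Γ₁} {a' : Act Γ Γ₂} {r : Act Γ₁ Γ'} {r' : Act Γ₂ Γ'}
      {P : Proc Γ} {R : Proc Γ₁} {R' : Proc Γ₂} {s : ActConc a a' r r'} {t : Trans P a R}
      {t' : Trans P a' R'} (d : Conc s t t') (Q : Proc Γ) : Conc s (.parL t Q) (.parL t' Q)
  | parR {Γ Γ₁ Γ₂ Γ' : ℕ} {a : Act Γ Γ₁} {a' : Act Γ Γ₂} {r : Act Γ₁ Γ'} {r' : Act Γ₂ Γ'}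
      (P : Proc Γ) {Q : Proc Γ} {S : Proc Γ₁} {S' : Proc Γ₂} {s : ActConc a a' r r'}
      {u : Trans Q a S} {u' : Trans Q a' S'} (d : Conc s u u') : Conc s (.parR P u) (.parR P u')
  -- two synchronisations
  | tauL_tauL {Γ : ℕ} {P Q : Proc Γ} {R R' : Proc (Γ + 1)} {S S' : Proc Γ} {x y x' z : Fin Γ}
      {t : Trans P (.b (.inp x)) R} {t' : Trans P (.b (.inp x')) R'}
      {u : Trans Q (.c (.out x y)) S} {u' : Trans Q (.c (.out x' z)) S'}
      (d : Conc (.bb (.inp x) (.inp x')) t t') (e : Conc (.cc (.out x y) (.out x' z)) u u') :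
      Conc (.cc .tau .tau) (.tauL t u) (.tauL t' u')
  | tauR_tauR {Γ : ℕ} {P Q : Proc Γ} {R R' : Proc Γ} {S S' : Proc (Γ + 1)} {x y x' z : Fin Γ}
      {t : Trans P (.c (.out x y)) R} {t' : Trans P (.c (.out x' z)) R'}
      {u : Trans Q (.b (.inp x)) S} {u' : Trans Q (.b (.inp x')) S'}
      (d : Conc (.cc (.out x y) (.out x' z)) t t') (e : Conc (.bb (.inp x) (.inp x')) u u') :
      Conc (.cc .tau .tau) (.tauR t u) (.tauR t' u')
  | tauL_tauR {Γ : ℕ} {P Q : Proc Γ} {R : Proc (Γ + 1)} {R' S : Proc Γ} {S' : Proc (Γ + 1)}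
      {x y x' z : Fin Γ} {t : Trans P (.b (.inp x)) R} {t' : Trans P (.c (.out x' z)) R'}
      {u : Trans Q (.c (.out x y)) S} {u' : Trans Q (.b (.inp x')) S'}
      (d : Conc (.bc (.inp x) (.out x' z)) t t') (e : Conc (.cb (.out x y) (.inp x')) u u') :
      Conc (.cc .tau .tau) (.tauL t u) (.tauR t' u')
  -- a synchronisation and a `ν`-synchronisation
  | tauL_nuL {Γ : ℕ} {P Q : Proc Γ} {R R' : Proc (Γ + 1)} {S : Proc Γ} {S' : Proc (Γ + 1)}
      {x y x' : Fin Γ} {t : Trans P (.b (.inp x)) R} {t' : Trans P (.b (.inp x')) R'}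
      {u : Trans Q (.c (.out x y)) S} {u' : Trans Q (.b (.bout x')) S'}
      (d : Conc (.bb (.inp x) (.inp x')) t t') (e : Conc (.cb (.out x y) (.bout x')) u u') :
      Conc (.cc .tau .tau) (.tauL t u) (.nuL t' u')
  | tauR_nuL {Γ : ℕ} {P Q : Proc Γ} {R : Proc Γ} {R' : Proc (Γ + 1)} {S S' : Proc (Γ + 1)}
      {x y x' : Fin Γ} {t : Trans P (.c (.out x y)) R} {t' : Trans P (.b (.inp x')) R'}
      {u : Trans Q (.b (.inp x)) S} {u' : Trans Q (.b (.bout x')) S'}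
      (d : Conc (.cb (.out x y) (.inp x')) t t') (e : Conc (.bb (.inp x) (.bout x')) u u') :
      Conc (.cc .tau .tau) (.tauR t u) (.nuL t' u')
  | tauL_nuR {Γ : ℕ} {P Q : Proc Γ} {R R' : Proc (Γ + 1)} {S : Proc Γ} {S' : Proc (Γ + 1)}
      {x y x' : Fin Γ} {t : Trans P (.b (.inp x)) R} {t' : Trans P (.b (.bout x')) R'}
      {u : Trans Q (.c (.out x y)) S} {u' : Trans Q (.b (.inp x')) S'}
      (d : Conc (.bb (.inp x) (.bout x')) t t') (e : Conc (.cb (.out x y) (.inp x')) u u') :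
      Conc (.cc .tau .tau) (.tauL t u) (.nuR t' u')
  | tauR_nuR {Γ : ℕ} {P Q : Proc Γ} {R : Proc Γ} {R' : Proc (Γ + 1)} {S S' : Proc (Γ + 1)}
      {x y x' : Fin Γ} {t : Trans P (.c (.out x y)) R} {t' : Trans P (.b (.bout x')) R'}
      {u : Trans Q (.b (.inp x)) S} {u' : Trans Q (.b (.inp x')) S'}
      (d : Conc (.cb (.out x y) (.bout x')) t t') (e : Conc (.bb (.inp x) (.inp x')) u u') :
      Conc (.cc .tau .tau) (.tauR t u) (.nuR t' u')
  -- two `ν`-synchronisations, of distinct binders or of the same binder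
  | nuL_nuL {Γ : ℕ} {P Q : Proc Γ} {R R' S S' : Proc (Γ + 1)} {x x' : Fin Γ}
      {t : Trans P (.b (.inp x)) R} {t' : Trans P (.b (.inp x')) R'}
      {u : Trans Q (.b (.bout x)) S} {u' : Trans Q (.b (.bout x')) S'}
      (d : Conc (.bb (.inp x) (.inp x')) t t') (e : Conc (.bb (.bout x) (.bout x')) u u') :
      Conc .nunu (.nuL t u) (.nuL t' u')
  | nuL_nuL_ext {Γ : ℕ} {P Q : Proc Γ} {R R' S S' : Proc (Γ + 1)} {x x' : Fin Γ}
      {t : Trans P (.b (.inp x)) R} {t' : Trans P (.b (.inp x')) R'}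
      {u : Trans Q (.b (.bout x)) S} {u' : Trans Q (.b (.bout x')) S'}
      (d : Conc (.bb (.inp x) (.inp x')) t t') (e : Conc (.ext x x') u u') :
      Conc (.cc .tau .tau) (.nuL t u) (.nuL t' u')
  | nuR_nuR {Γ : ℕ} {P Q : Proc Γ} {R R' S S' : Proc (Γ + 1)} {x x' : Fin Γ}
      {t : Trans P (.b (.bout x)) R} {t' : Trans P (.b (.bout x')) R'}
      {u : Trans Q (.b (.inp x)) S} {u' : Trans Q (.b (.inp x')) S'}
      (d : Conc (.bb (.bout x) (.bout x')) t t') (e : Conc (.bb (.inp x) (.inp x')) u u') :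
      Conc .nunu (.nuR t u) (.nuR t' u')
  | nuR_nuR_ext {Γ : ℕ} {P Q : Proc Γ} {R R' S S' : Proc (Γ + 1)} {x x' : Fin Γ}
      {t : Trans P (.b (.bout x)) R} {t' : Trans P (.b (.bout x')) R'}
      {u : Trans Q (.b (.inp x)) S} {u' : Trans Q (.b (.inp x')) S'}
      (d : Conc (.ext x x') t t') (e : Conc (.bb (.inp x) (.inp x')) u u') :
      Conc (.cc .tau .tau) (.nuR t u) (.nuR t' u')
  | nuL_nuR {Γ : ℕ} {P Q : Proc Γ} {R R' S S' : Proc (Γ + 1)} {x x' : Fin Γ}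
      {t : Trans P (.b (.inp x)) R} {t' : Trans P (.b (.bout x')) R'}
      {u : Trans Q (.b (.bout x)) S} {u' : Trans Q (.b (.inp x')) S'}
      (d : Conc (.bb (.inp x) (.bout x')) t t') (e : Conc (.bb (.bout x) (.inp x')) u u') :
      Conc .nunu (.nuL t u) (.nuR t' u')
  -- propagation through a binder
  | extr_extr {Γ : ℕ} {P R R' : Proc (Γ + 1)} {x x' : Fin Γ} {c c' : CAct (Γ + 1)}
      {t : Trans P (.c c) R} {t' : Trans P (.c c') R'} (h : c = .out x.succ 0)
      (h' : c' = .out x'.succ 0) (d : Conc (.cc c c') t t') :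
      Conc (.ext x x') (.extr h t) (.extr h' t')
  | extr_nuB {Γ : ℕ} {P R : Proc (Γ + 1)} {R' : Proc (Γ + 2)} {x : Fin Γ} {b : BAct Γ}
      {c : CAct (Γ + 1)} {b₁ : BAct (Γ + 1)} {t : Trans P (.c c) R} {t' : Trans P (.b b₁) R'}
      (h : c = .out x.succ 0) (h' : b₁ = b.ren push) (d : Conc (.cb c b₁) t t') :
      Conc (.bb (.bout x) b) (.extr h t) (.nuB h' t')
  | extr_nuC {Γ : ℕ} {P R R' : Proc (Γ + 1)} {x : Fin Γ} {c' : CAct Γ}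
      {c c₁ : CAct (Γ + 1)} {t : Trans P (.c c) R} {t' : Trans P (.c c₁) R'}
      (h : c = .out x.succ 0) (h' : c₁ = c'.ren push) (d : Conc (.cc c c₁) t t') :
      Conc (.bc (.bout x) c') (.extr h t) (.nuC h' t')
  | nuB_nuB {Γ : ℕ} {P : Proc (Γ + 1)} {R R' : Proc (Γ + 2)} {b b' : BAct Γ}
      {b₁ b₁' : BAct (Γ + 1)} {t : Trans P (.b b₁) R} {t' : Trans P (.b b₁') R'}
      (h : b₁ = b.ren push) (h' : b₁' = b'.ren push) (d : Conc (.bb b₁ b₁') t t') :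
      Conc (.bb b b') (.nuB h t) (.nuB h' t')
  | nuB_nuB_ext {Γ : ℕ} {P : Proc (Γ + 1)} {R R' : Proc (Γ + 2)} {x x' : Fin Γ}
      {x₁ x₁' : Fin (Γ + 1)} {t : Trans P (.b (.bout x₁)) R} {t' : Trans P (.b (.bout x₁')) R'}
      (h : BAct.bout x₁ = (BAct.bout x).ren push) (h' : BAct.bout x₁' = (BAct.bout x').ren push)
      (d : Conc (.ext x₁ x₁') t t') : Conc (.ext x x') (.nuB h t) (.nuB h' t')
  | nuB_nuC {Γ : ℕ} {P : Proc (Γ + 1)} {R : Proc (Γ + 2)} {R' : Proc (Γ + 1)} {b : BAct Γ}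
      {c : CAct Γ} {b₁ : BAct (Γ + 1)} {c₁ : CAct (Γ + 1)} {t : Trans P (.b b₁) R}
      {t' : Trans P (.c c₁) R'} (h : b₁ = b.ren push) (h' : c₁ = c.ren push)
      (d : Conc (.bc b₁ c₁) t t') : Conc (.bc b c) (.nuB h t) (.nuC h' t')
  | nuC_nuC {Γ : ℕ} {P R R' : Proc (Γ + 1)} {c c' : CAct Γ} {c₁ c₁' : CAct (Γ + 1)}
      {t : Trans P (.c c₁) R} {t' : Trans P (.c c₁') R'} (h : c₁ = c.ren push)
      (h' : c₁' = c'.ren push) (d : Conc (.cc c₁ c₁') t t') :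
      Conc (.cc c c') (.nuC h t) (.nuC h' t')
  | nuC_nuC_nunu {Γ : ℕ} {P R R' : Proc (Γ + 1)} {t : Trans P (.c .tau) R}
      {t' : Trans P (.c .tau) R'} (h h' : (CAct.tau : CAct (Γ + 1)) = (CAct.tau : CAct Γ).ren push)
      (d : Conc .nunu t t') : Conc .nunu (.nuC h t) (.nuC h' t')
  -- propagation through replication
  | repl {Γ Γ₁ Γ₂ Γ' : ℕ} {a : Act Γ Γ₁} {a' : Act Γ Γ₂} {r : Act Γ₁ Γ'} {r' : Act Γ₂ Γ'}
      {P : Proc Γ} {R : Proc Γ₁} {R' : Proc Γ₂} {s : ActConc a a' r r'}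
      {t : Trans (.par P (.repl P)) a R} {t' : Trans (.par P (.repl P)) a' R'}
      (d : Conc s t t') : Conc s (.repl t) (.repl t')

/-- The residuals `t'/t` and `t/t'` of concurrent transitions with target states `R`, `R'`,
with the braiding `γ` that relates the targets of the residuals. -/
structure Pentagon {Γ Γ₁ Γ₂ Γ' : ℕ} {a : Act Γ Γ₁} {a' : Act Γ Γ₂} {r : Act Γ₁ Γ'}
    {r' : Act Γ₂ Γ'} (s : ActConc a a' r r') (R : Proc Γ₁) (R' : Proc Γ₂) : Type where
  {Q Q' : Proc Γ'}
  /-- `t'/t` -/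
  upper : Trans R r Q
  /-- `t/t'` -/
  lower : Trans R' r' Q'
  /-- the braiding -/
  γ : s.Braiding Q Q'

theorem Proc.swap_lift_push {Γ : ℕ} (S : Proc (Γ + 1)) :
    S.ren (lift push) = (S.ren push).ren swap := by
  rw [Proc.ren_ren]; rfl

theorem Proc.swap_push {Γ : ℕ} (S : Proc (Γ + 1)) :
    S.ren push = (S.ren (lift push)).ren swap := by
  rw [Proc.swap_lift_push, Proc.swap_swap]

theorem Proc.pop_succ_swap {Γ : ℕ} (y : Fin Γ) (P : Proc (Γ + 2)) :
    (P.ren swap).ren (pop y.succ) = P.ren (lift (pop y)) := by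
  rw [Proc.ren_ren]; congr 1; funext i
  refine Fin.cases rfl (fun i => Fin.cases rfl (fun i => rfl) i) i

theorem Proc.lift_pop_swap {Γ : ℕ} (y : Fin Γ) (P : Proc (Γ + 2)) :
    (P.ren swap).ren (lift (pop y)) = P.ren (pop y.succ) := by
  rw [Proc.ren_ren]; congr 1; funext i
  refine Fin.cases rfl (fun i => Fin.cases rfl (fun i => rfl) i) i

theorem Proc.pop_lift_pop_swap {Γ : ℕ} (y z : Fin Γ) (P : Proc (Γ + 2)) :
    ((P.ren swap).ren (lift (pop y))).ren (pop z) = (P.ren (lift (pop z))).ren (pop y) := by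
  simp only [Proc.ren_ren]; congr 1; funext i
  refine Fin.cases rfl (fun i => Fin.cases rfl (fun i => rfl) i) i

theorem Proc.pop_zero_swap {Γ : ℕ} (P : Proc (Γ + 2)) :
    (P.ren swap).ren (pop 0) = P.ren (pop 0) := by
  simp only [Proc.ren_ren]; congr 1; funext i
  refine Fin.cases rfl (fun i => Fin.cases rfl (fun i => rfl) i) i

theorem Proc.pop_lift_push {Γ : ℕ} (S : Proc (Γ + 1)) : (S.ren (lift push)).ren (pop 0) = S := by
  rw [Proc.ren_ren]
  have : (pop 0 ∘ lift push : Fin (Γ + 1) → Fin (Γ + 1)) = id := by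
    funext i; refine Fin.cases rfl (fun i => rfl) i
  rw [this, Proc.ren_id]

theorem Proc.hexagon {Γ : ℕ} (P : Proc (Γ + 3)) :
    ((P.ren swap).ren (lift swap)).ren swap = ((P.ren (lift swap)).ren swap).ren (lift swap) := by
  simp only [Proc.ren_ren]; congr 1; funext i
  refine Fin.cases rfl (fun i => Fin.cases rfl (fun i => Fin.cases rfl (fun i => rfl) i) i) i

theorem Proc.hexagon' {Γ : ℕ} (P : Proc (Γ + 3)) :
    (P.ren swap).ren (lift swap) =
      (((P.ren (lift swap)).ren swap).ren (lift swap)).ren swap := by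
  rw [← Proc.hexagon, Proc.swap_swap]

theorem BAct.pop_push {Γ : ℕ} (y : Fin Γ) (b : BAct Γ) : (b.ren push).ren (pop y) = b := by
  cases b <;> rfl

theorem CAct.pop_push {Γ : ℕ} (y : Fin Γ) (c : CAct Γ) : (c.ren push).ren (pop y) = c := by
  cases c <;> rfl

theorem BAct.swap_push_push {Γ : ℕ} (b : BAct Γ) :
    ((b.ren push).ren push).ren swap = (b.ren push).ren push := by
  cases b <;> rfl

theorem CAct.swap_push_push {Γ : ℕ} (c : CAct Γ) :
    ((c.ren push).ren push).ren swap = (c.ren push).ren push := by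
  cases c <;> rfl

/-- Residuals of concurrent transitions and their braiding. -/
def Conc.pentagon : {Γ Γ₁ Γ₂ Γ' : ℕ} → {a : Act Γ Γ₁} → {a' : Act Γ Γ₂} → {r : Act Γ₁ Γ'} →
    {r' : Act Γ₂ Γ'} → {P : Proc Γ} → {R : Proc Γ₁} → {R' : Proc Γ₂} →
    {s : ActConc a a' r r'} → {t : Trans P a R} → {t' : Trans P a' R'} →
    Conc s t t' → Pentagon s R R'
  | _, _, _, _, _, _, _, _, _, _, _, _, _, _, .symm d =>
      ⟨d.pentagon.lower, d.pentagon.upper, ActConc.braidingSymm _ d.pentagon.γ⟩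
  -- transitions on opposite sides of a parallel composition
  | _, _, _, _, _, _, _, _, _, _, _, _, _, _, .parR_parL_bb (R := R) (S := S) t u =>
      ⟨.parL (t.renB push) S, .parR R (u.renB push),
        ⟨congrArg₂ Proc.par R.swap_lift_push S.swap_push⟩⟩
  | _, _, _, _, _, _, _, _, _, _, _, _, _, _, .parR_parL_bc (R := R) (S := S) t u =>
      ⟨.parL (t.renC push) S, .parR R u, ⟨rfl⟩⟩
  | _, _, _, _, _, _, _, _, _, _, _, _, _, _, .parR_parL_cb (R := R) (S := S) t u =>
      ⟨.parL t S, .parR R (u.renC push), ⟨rfl⟩⟩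
  | _, _, _, _, _, _, _, _, _, _, _, _, _, _, .parR_parL_cc (R := R) (S := S) t u =>
      ⟨.parL t S, .parR R u, ⟨rfl⟩⟩
  -- propagation on one side, synchronisation
  | _, _, _, _, _, _, _, _, _, _, _, _, _, _, .parL_tauL_b (S := S) (y := y) d u =>
      ⟨.tauL d.pentagon.upper (u.renC push),
        .parL ((d.pentagon.lower.renB (pop y)).castB rfl (BAct.pop_push _ _) rfl) S,
        ⟨congrArg₂ Proc.par ((congrArg _ d.pentagon.γ.down).trans (Proc.pop_succ_swap y _)) rfl⟩⟩
  | _, _, _, _, _, _, _, _, _, _, _, _, _, _, .parL_tauL_c (S := S) (y := y) d u =>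
      ⟨.tauL d.pentagon.upper u,
        .parL ((d.pentagon.lower.renC (pop y)).castC rfl (CAct.pop_push _ _) rfl) S,
        ⟨congrArg₂ Proc.par (congrArg _ d.pentagon.γ.down) rfl⟩⟩
  | _, _, _, _, _, _, _, _, _, _, _, _, _, _, .parL_tauR_b (S := S) (y := y) d u =>
      ⟨.tauR d.pentagon.upper (u.renB push), .parL d.pentagon.lower (S.ren (pop y)),
        ⟨congrArg₂ Proc.par d.pentagon.γ.down (Proc.pop_lift_ren push y S)⟩⟩
  | _, _, _, _, _, _, _, _, _, _, _, _, _, _, .parL_tauR_c (S := S) (y := y) d u =>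
      ⟨.tauR d.pentagon.upper u, .parL d.pentagon.lower (S.ren (pop y)),
        ⟨congrArg₂ Proc.par d.pentagon.γ.down rfl⟩⟩
  | _, _, _, _, _, _, _, _, _, _, _, _, _, _, .parR_tauL_b (R := R) (y := y) t d =>
      ⟨.tauL (t.renB push) d.pentagon.upper, .parR (R.ren (pop y)) d.pentagon.lower,
        ⟨congrArg₂ Proc.par (Proc.pop_lift_ren push y R) d.pentagon.γ.down⟩⟩
  | _, _, _, _, _, _, _, _, _, _, _, _, _, _, .parR_tauL_c (R := R) (y := y) t d =>
      ⟨.tauL t d.pentagon.upper, .parR (R.ren (pop y)) d.pentagon.lower,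
        ⟨congrArg₂ Proc.par rfl d.pentagon.γ.down⟩⟩
  | _, _, _, _, _, _, _, _, _, _, _, _, _, _, .parR_tauR_b (R := R) (y := y) t d =>
      ⟨.tauR (t.renC push) d.pentagon.upper,
        .parR R ((d.pentagon.lower.renB (pop y)).castB rfl (BAct.pop_push _ _) rfl),
        ⟨congrArg₂ Proc.par rfl ((congrArg _ d.pentagon.γ.down).trans (Proc.pop_succ_swap y _))⟩⟩
  | _, _, _, _, _, _, _, _, _, _, _, _, _, _, .parR_tauR_c (R := R) (y := y) t d =>
      ⟨.tauR t d.pentagon.upper,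
        .parR R ((d.pentagon.lower.renC (pop y)).castC rfl (CAct.pop_push _ _) rfl),
        ⟨congrArg₂ Proc.par rfl (congrArg _ d.pentagon.γ.down)⟩⟩
  -- propagation on one side, `ν`-synchronisation
  | _, _, _, _, _, _, _, _, _, _, _, _, _, _, .parL_nuL_b (S := S) d u =>
      ⟨.nuL d.pentagon.upper (u.renB push), .nuB rfl (.parL d.pentagon.lower S),
        ⟨congrArg Proc.nu (congrArg₂ Proc.par d.pentagon.γ.down S.swap_lift_push)⟩⟩
  | _, _, _, _, _, _, _, _, _, _, _, _, _, _, .parL_nuL_c (S := S) d u =>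
      ⟨.nuL d.pentagon.upper u, .nuC rfl (.parL d.pentagon.lower S),
        ⟨congrArg Proc.nu (congrArg₂ Proc.par d.pentagon.γ.down rfl)⟩⟩
  | _, _, _, _, _, _, _, _, _, _, _, _, _, _, .parL_nuR_b (S := S) d u =>
      ⟨.nuR d.pentagon.upper (u.renB push), .nuB rfl (.parL d.pentagon.lower S),
        ⟨congrArg Proc.nu (congrArg₂ Proc.par d.pentagon.γ.down S.swap_lift_push)⟩⟩
  | _, _, _, _, _, _, _, _, _, _, _, _, _, _, .parL_nuR_ext (S := S) d u =>
      ⟨.tauR d.pentagon.upper (u.renB push), .extr rfl (.parL d.pentagon.lower S),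
        ⟨congrArg₂ Proc.par d.pentagon.γ.down S.pop_lift_push⟩⟩
  | _, _, _, _, _, _, _, _, _, _, _, _, _, _, .parL_nuR_c (S := S) d u =>
      ⟨.nuR d.pentagon.upper u, .nuC rfl (.parL d.pentagon.lower S),
        ⟨congrArg Proc.nu (congrArg₂ Proc.par d.pentagon.γ.down rfl)⟩⟩
  | _, _, _, _, _, _, _, _, _, _, _, _, _, _, .parR_nuL_b (R := R) t d =>
      ⟨.nuL (t.renB push) d.pentagon.upper, .nuB rfl (.parR R d.pentagon.lower),
        ⟨congrArg Proc.nu (congrArg₂ Proc.par R.swap_lift_push d.pentagon.γ.down)⟩⟩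
  | _, _, _, _, _, _, _, _, _, _, _, _, _, _, .parR_nuL_ext (R := R) t d =>
      ⟨.tauL (t.renB push) d.pentagon.upper, .extr rfl (.parR R d.pentagon.lower),
        ⟨congrArg₂ Proc.par R.pop_lift_push d.pentagon.γ.down⟩⟩
  | _, _, _, _, _, _, _, _, _, _, _, _, _, _, .parR_nuL_c (R := R) t d =>
      ⟨.nuL t d.pentagon.upper, .nuC rfl (.parR R d.pentagon.lower),
        ⟨congrArg Proc.nu (congrArg₂ Proc.par rfl d.pentagon.γ.down)⟩⟩
  | _, _, _, _, _, _, _, _, _, _, _, _, _, _, .parR_nuR_b (R := R) t d =>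
      ⟨.nuR (t.renB push) d.pentagon.upper, .nuB rfl (.parR R d.pentagon.lower),
        ⟨congrArg Proc.nu (congrArg₂ Proc.par R.swap_lift_push d.pentagon.γ.down)⟩⟩
  | _, _, _, _, _, _, _, _, _, _, _, _, _, _, .parR_nuR_c (R := R) t d =>
      ⟨.nuR t d.pentagon.upper, .nuC rfl (.parR R d.pentagon.lower),
        ⟨congrArg Proc.nu (congrArg₂ Proc.par rfl d.pentagon.γ.down)⟩⟩
  -- propagation through choice and parallel composition on the same side
  | _, _, _, _, _, _, _, _, _, _, _, _, _, _, .choiceL d _ => d.pentagon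
  | _, _, _, _, _, _, _, _, _, _, _, _, _, _, .choiceR _ d => d.pentagon
  | _, _, _, _, a, a', _, _, _, _, _, _, _, _, .parL d Q =>
      ⟨.parL d.pentagon.upper (a.push Q), .parL d.pentagon.lower (a'.push Q),
        ActConc.braidingParL _ d.pentagon.γ Q⟩
  | _, _, _, _, a, a', _, _, _, _, _, _, _, _, .parR P d =>
      ⟨.parR (a.push P) d.pentagon.upper, .parR (a'.push P) d.pentagon.lower,
        ActConc.braidingParR _ d.pentagon.γ P⟩
  -- two synchronisations
  | _, _, _, _, _, _, _, _, _, _, _, _, _, _, .tauL_tauL (y := y) (z := z) d e =>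
      ⟨.tauL (d.pentagon.upper.renB (pop y)) e.pentagon.upper,
        .tauL (d.pentagon.lower.renB (pop z)) e.pentagon.lower,
        ⟨congrArg₂ Proc.par
          ((congrArg (fun X => (Proc.ren (lift (pop y)) X).ren (pop z)) d.pentagon.γ.down).trans
            (Proc.pop_lift_pop_swap y z _)) e.pentagon.γ.down⟩⟩
  | _, _, _, _, _, _, _, _, _, _, _, _, _, _, .tauR_tauR (y := y) (z := z) d e =>
      ⟨.tauR d.pentagon.upper (e.pentagon.upper.renB (pop y)),
        .tauR d.pentagon.lower (e.pentagon.lower.renB (pop z)),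
        ⟨congrArg₂ Proc.par d.pentagon.γ.down
          ((congrArg (fun X => (Proc.ren (lift (pop y)) X).ren (pop z)) e.pentagon.γ.down).trans
            (Proc.pop_lift_pop_swap y z _))⟩⟩
  | _, _, _, _, _, _, _, _, _, _, _, _, _, _, .tauL_tauR (y := y) (z := z) d e =>
      ⟨.tauR (d.pentagon.upper.renC (pop y)) e.pentagon.upper,
        .tauL d.pentagon.lower (e.pentagon.lower.renC (pop z)),
        ⟨congrArg₂ Proc.par (congrArg _ d.pentagon.γ.down) (congrArg _ e.pentagon.γ.down)⟩⟩
  -- a synchronisation and a `ν`-synchronisation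
  | _, _, _, _, _, _, _, _, _, _, _, _, _, _, .tauL_nuL (y := y) d e =>
      ⟨.nuL (d.pentagon.upper.renB (pop y)) e.pentagon.upper,
        .nuC rfl (.tauL d.pentagon.lower e.pentagon.lower),
        ⟨congrArg Proc.nu (congrArg₂ Proc.par
          ((congrArg _ d.pentagon.γ.down).trans (Proc.lift_pop_swap y _)) e.pentagon.γ.down)⟩⟩
  | _, _, _, _, _, _, _, _, _, _, _, _, _, _, .tauR_nuL (y := y) d e =>
      ⟨.nuL d.pentagon.upper (e.pentagon.upper.renB (pop y)),
        .nuC rfl (.tauR d.pentagon.lower e.pentagon.lower),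
        ⟨congrArg Proc.nu (congrArg₂ Proc.par d.pentagon.γ.down
          ((congrArg _ e.pentagon.γ.down).trans (Proc.lift_pop_swap y _)))⟩⟩
  | _, _, _, _, _, _, _, _, _, _, _, _, _, _, .tauL_nuR (y := y) d e =>
      ⟨.nuR (d.pentagon.upper.renB (pop y)) e.pentagon.upper,
        .nuC rfl (.tauL d.pentagon.lower e.pentagon.lower),
        ⟨congrArg Proc.nu (congrArg₂ Proc.par
          ((congrArg _ d.pentagon.γ.down).trans (Proc.lift_pop_swap y _)) e.pentagon.γ.down)⟩⟩
  | _, _, _, _, _, _, _, _, _, _, _, _, _, _, .tauR_nuR (y := y) d e =>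
      ⟨.nuR d.pentagon.upper (e.pentagon.upper.renB (pop y)),
        .nuC rfl (.tauR d.pentagon.lower e.pentagon.lower),
        ⟨congrArg Proc.nu (congrArg₂ Proc.par d.pentagon.γ.down
          ((congrArg _ e.pentagon.γ.down).trans (Proc.lift_pop_swap y _)))⟩⟩
  -- two `ν`-synchronisations, of distinct binders or of the same binder
  | _, _, _, _, _, _, _, _, _, _, _, _, _, _, .nuL_nuL d e =>
      ⟨.nuC rfl (.nuL d.pentagon.upper e.pentagon.upper),
        .nuC rfl (.nuL d.pentagon.lower e.pentagon.lower),
        .swap (congrArg₂ Proc.par d.pentagon.γ.down e.pentagon.γ.down)⟩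
  | _, _, _, _, _, _, _, _, _, _, _, _, _, _, .nuL_nuL_ext d e =>
      ⟨.nuC rfl (.tauL d.pentagon.upper e.pentagon.upper),
        .nuC rfl (.tauL d.pentagon.lower e.pentagon.lower),
        ⟨congrArg Proc.nu (congrArg₂ Proc.par
          ((congrArg _ d.pentagon.γ.down).trans (Proc.pop_zero_swap _)) e.pentagon.γ.down)⟩⟩
  | _, _, _, _, _, _, _, _, _, _, _, _, _, _, .nuR_nuR d e =>
      ⟨.nuC rfl (.nuR d.pentagon.upper e.pentagon.upper),
        .nuC rfl (.nuR d.pentagon.lower e.pentagon.lower),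
        .swap (congrArg₂ Proc.par d.pentagon.γ.down e.pentagon.γ.down)⟩
  | _, _, _, _, _, _, _, _, _, _, _, _, _, _, .nuR_nuR_ext d e =>
      ⟨.nuC rfl (.tauR d.pentagon.upper e.pentagon.upper),
        .nuC rfl (.tauR d.pentagon.lower e.pentagon.lower),
        ⟨congrArg Proc.nu (congrArg₂ Proc.par d.pentagon.γ.down
          ((congrArg _ e.pentagon.γ.down).trans (Proc.pop_zero_swap _)))⟩⟩
  | _, _, _, _, _, _, _, _, _, _, _, _, _, _, .nuL_nuR d e =>
      ⟨.nuC rfl (.nuR d.pentagon.upper e.pentagon.upper),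
        .nuC rfl (.nuL d.pentagon.lower e.pentagon.lower),
        .swap (congrArg₂ Proc.par d.pentagon.γ.down e.pentagon.γ.down)⟩
  -- propagation through a binder
  | _, _, _, _, _, _, _, _, _, _, _, _, _, _, .extr_extr h h' d =>
      ⟨d.pentagon.upper.castC rfl h' rfl, d.pentagon.lower.castC rfl h rfl, ⟨d.pentagon.γ.down⟩⟩
  | _, _, _, _, _, _, _, _, _, _, _, _, _, _, .extr_nuB h h' d =>
      ⟨d.pentagon.upper.castB rfl h' rfl,
        .extr (by subst h; rfl) (d.pentagon.lower.renC swap),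
        ⟨d.pentagon.γ.down.trans (Proc.swap_swap _).symm⟩⟩
  | _, _, _, _, _, _, _, _, _, _, _, _, _, _, .extr_nuC h h' d =>
      ⟨d.pentagon.upper.castC rfl h' rfl, .extr h d.pentagon.lower, ⟨d.pentagon.γ.down⟩⟩
  | _, _, _, _, _, _, _, _, _, _, _, _, _, _, .nuB_nuB h h' d =>
      ⟨.nuB (by subst h'; exact BAct.swap_push_push _) (d.pentagon.upper.renB swap),
        .nuB (by subst h; exact BAct.swap_push_push _) (d.pentagon.lower.renB swap),
        ⟨congrArg Proc.nu
          ((congrArg (fun X => (Proc.ren (lift swap) X).ren swap) d.pentagon.γ.down).trans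
            (Proc.hexagon _))⟩⟩
  | _, _, _, _, _, _, _, _, _, _, _, _, _, _, .nuB_nuB_ext h h' d =>
      ⟨.nuC (by cases h'; rfl) (d.pentagon.upper.renC swap),
        .nuC (by cases h; rfl) (d.pentagon.lower.renC swap),
        ⟨congrArg Proc.nu (congrArg _ d.pentagon.γ.down)⟩⟩
  | _, _, _, _, _, _, _, _, _, _, _, _, _, _, .nuB_nuC h h' d =>
      ⟨.nuC (by subst h'; exact CAct.swap_push_push _) (d.pentagon.upper.renC swap),
        .nuB h d.pentagon.lower,
        ⟨congrArg Proc.nu (congrArg _ d.pentagon.γ.down)⟩⟩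
  | _, _, _, _, _, _, _, _, _, _, _, _, _, _, .nuC_nuC h h' d =>
      ⟨.nuC h' d.pentagon.upper, .nuC h d.pentagon.lower, ⟨congrArg Proc.nu d.pentagon.γ.down⟩⟩
  | _, _, _, _, _, _, _, _, _, _, _, _, _, _, .nuC_nuC_nunu h h' d =>
      ⟨.nuC h' d.pentagon.upper, .nuC h d.pentagon.lower, .nu d.pentagon.γ⟩
  -- propagation through replication
  | _, _, _, _, _, _, _, _, _, _, _, _, _, _, .repl d => d.pentagon

/-! ### Residuals of transitions and bound braids -/

/-- Bound braids are closed under renamings. -/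
def BoundBraid.ren : {Γ Δ : ℕ} → {P R : Proc Γ} → BoundBraid P R → (ρ : Fin Γ → Fin Δ) →
    BoundBraid (P.ren ρ) (R.ren ρ)
  | _, _, _, _, .swap (R := R) h, ρ =>
      .swap (show _ = _ from (congrArg _ h).trans (R.swap_lift_ren ρ).symm)
  | _, _, _, _, .nil, _ => .nil
  | _, _, _, _, .inp x P, ρ => .inp (ρ x) (P.ren (lift ρ))
  | _, _, _, _, .out x y P, ρ => .out (ρ x) (ρ y) (P.ren ρ)
  | _, _, _, _, .choiceL φ Q, ρ => .choiceL (φ.ren ρ) (Q.ren ρ)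
  | _, _, _, _, .choiceR P ψ, ρ => .choiceR (P.ren ρ) (ψ.ren ρ)
  | _, _, _, _, .par φ ψ, ρ => .par (φ.ren ρ) (ψ.ren ρ)
  | _, _, _, _, .nu φ, ρ => .nu (φ.ren (lift ρ))
  | _, _, _, _, .repl φ, ρ => .repl (φ.ren ρ)

/-- A bound braid moved to the target context of an action. -/
def BoundBraid.push : {Γ Γ' : ℕ} → (a : Act Γ Γ') → {P R : Proc Γ} → BoundBraid P R →
    BoundBraid (a.push P) (a.push R)
  | _, _, .b _, _, _, φ => φ.ren PiCalculus.push
  | _, _, .c _, _, _, φ => φ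

/-- For `t : P —a→ R` and a bound braid `φ` between `P` and `P'`: a process `R'`, the residual
`t/φ : P' —a→ R'` and the residual bound braid `φ/t` between `R` and `R'`. -/
structure BoundSquare {Γ Γ' : ℕ} (a : Act Γ Γ') (P' : Proc Γ) (R : Proc Γ') : Type where
  {R' : Proc Γ'}
  /-- `t/φ` -/
  trans : Trans P' a R'
  /-- `φ/t` -/
  braid : BoundBraid R R'

theorem FreeBraid.ren_eq {Γ : ℕ} {P R : Proc (Γ + 2)} (h : FreeBraid P R) : P.ren swap = R := by
  rw [show P = R.ren swap from h, Proc.swap_swap]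

/-- `t/φ` and `φ/t` where `φ` transposes two binders and `t` extrudes the outer one. -/
def Trans.swapExtr : {Γ : ℕ} → {P P' : Proc (Γ + 2)} → {x : Fin Γ} → {c : CAct (Γ + 1)} →
    {R : Proc (Γ + 1)} → c = .out x.succ 0 → Trans (.nu P) (.c c) R → FreeBraid P P' →
    BoundSquare (.b (.bout x)) (.nu (.nu P')) R
  | _, _, _, x, _, _, h, .nuC (R := R₀) h₁ t, hP =>
      ⟨(Trans.nuB (b := .bout x) (b₁ := .bout x.succ) rfl (.extr (by subst h; subst h₁; rfl)
        ((t.renC PiCalculus.swap).castC hP.ren_eq rfl rfl))).castB rfl rfl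
          (congrArg Proc.nu R₀.swap_swap), .refl _⟩

/-- `t/φ` and `φ/t` where `φ` transposes two binders and a bound action propagates through the
outer one. -/
def Trans.swapNuB : {Γ : ℕ} → {P P' : Proc (Γ + 2)} → {b : BAct Γ} → {b₁ : BAct (Γ + 1)} →
    {R : Proc (Γ + 2)} → b₁ = b.ren push → Trans (.nu P) (.b b₁) R → FreeBraid P P' →
    BoundSquare (.b b) (.nu (.nu P')) (.nu (R.ren swap))
  | _, _, _, .inp _, _, _, h, .extr _ _, _ => nomatch h
  | _, _, _, .bout x, _, _, h, .extr h₁ t, hP =>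
      ⟨.extr (c := .out x.succ 0) rfl (.nuC (c := .out x.succ 0)
        (by subst h₁; cases h; rfl) ((t.renC PiCalculus.swap).castC hP.ren_eq rfl rfl)), .refl _⟩
  | _, _, _, _, _, _, h, .nuB (R := R₀) h₁ t, hP =>
      ⟨.nuB h (.nuB (by subst h; subst h₁; exact BAct.swap_push_push _)
        ((t.renB PiCalculus.swap).castB hP.ren_eq rfl rfl)), .swap R₀.hexagon'⟩

/-- `t/φ` and `φ/t` where `φ` transposes two binders and a non-bound action propagates through the
outer one. -/
def Trans.swapNuC : {Γ : ℕ} → {P P' : Proc (Γ + 2)} → {c : CAct Γ} → {c₁ : CAct (Γ + 1)} →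
    {R : Proc (Γ + 1)} → c₁ = c.ren push → Trans (.nu P) (.c c₁) R → FreeBraid P P' →
    BoundSquare (.c c) (.nu (.nu P')) (.nu R)
  | _, _, _, _, _, _, h, .nuC (R := R₀) h₁ t, hP =>
      ⟨.nuC h (.nuC (by subst h; subst h₁; exact CAct.swap_push_push _)
        ((t.renC PiCalculus.swap).castC hP.ren_eq rfl rfl)), .swap R₀.swap_swap.symm⟩

/-- The residuals `t/φ` and `φ/t`. -/
def Trans.boundRes : {Γ Γ' : ℕ} → {P P' : Proc Γ} → {a : Act Γ Γ'} → {R : Proc Γ'} →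
    Trans P a R → BoundBraid P P' → BoundSquare a P' R
  | _, _, _, _, _, _, .inp x P, .inp _ _ => ⟨.inp x P, .refl P⟩
  | _, _, _, _, _, _, .out x y P, .out _ _ _ => ⟨.out x y P, .refl P⟩
  | _, _, _, _, _, _, .choiceL t Q, .choiceL φ _ =>
      ⟨.choiceL (t.boundRes φ).trans Q, (t.boundRes φ).braid⟩
  | _, _, _, _, _, _, .choiceL t _, .choiceR (S := S) _ _ => ⟨.choiceL t S, .refl _⟩
  | _, _, _, _, _, _, .choiceR P u, .choiceR _ ψ =>
      ⟨.choiceR P (u.boundRes ψ).trans, (u.boundRes ψ).braid⟩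
  | _, _, _, _, _, _, .choiceR _ u, .choiceL (R := R) _ _ => ⟨.choiceR R u, .refl _⟩
  | _, _, _, _, a, _, .parL t _, .par (S := S) φ ψ =>
      ⟨.parL (t.boundRes φ).trans S, .par (t.boundRes φ).braid (ψ.push a)⟩
  | _, _, _, _, a, _, .parR _ u, .par (R := R) φ ψ =>
      ⟨.parR R (u.boundRes ψ).trans, .par (φ.push a) (u.boundRes ψ).braid⟩
  | _, _, _, _, _, _, .tauL (y := y) t u, .par φ ψ =>
      ⟨.tauL (t.boundRes φ).trans (u.boundRes ψ).trans,
        .par ((t.boundRes φ).braid.ren (pop y)) (u.boundRes ψ).braid⟩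
  | _, _, _, _, _, _, .tauR (y := y) t u, .par φ ψ =>
      ⟨.tauR (t.boundRes φ).trans (u.boundRes ψ).trans,
        .par (t.boundRes φ).braid ((u.boundRes ψ).braid.ren (pop y))⟩
  | _, _, _, _, _, _, .nuL t u, .par φ ψ =>
      ⟨.nuL (t.boundRes φ).trans (u.boundRes ψ).trans,
        .nu (.par (t.boundRes φ).braid (u.boundRes ψ).braid)⟩
  | _, _, _, _, _, _, .nuR t u, .par φ ψ =>
      ⟨.nuR (t.boundRes φ).trans (u.boundRes ψ).trans,
        .nu (.par (t.boundRes φ).braid (u.boundRes ψ).braid)⟩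
  | _, _, _, _, _, _, .extr h t, .nu φ => ⟨.extr h (t.boundRes φ).trans, (t.boundRes φ).braid⟩
  | _, _, _, _, _, _, .extr h t, .swap hP => t.swapExtr h hP
  | _, _, _, _, _, _, .nuB h t, .nu φ =>
      ⟨.nuB h (t.boundRes φ).trans, .nu ((t.boundRes φ).braid.ren PiCalculus.swap)⟩
  | _, _, _, _, _, _, .nuB h t, .swap hP => t.swapNuB h hP
  | _, _, _, _, _, _, .nuC h t, .nu φ => ⟨.nuC h (t.boundRes φ).trans, .nu (t.boundRes φ).braid⟩
  | _, _, _, _, _, _, .nuC h t, .swap hP => t.swapNuC h hP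
  | _, _, _, _, _, _, .repl t, .repl φ =>
      ⟨.repl (t.boundRes (.par φ (.repl φ))).trans, (t.boundRes (.par φ (.repl φ))).braid⟩

/-! ### Generalised braidings and their residuals -/

/-- The renaming `swap + Δ` of names in `n = Γ + 2 + Δ`. -/
def swapN {Γ : ℕ} (Δ : ℕ) {n : ℕ} (h : Γ + 2 + Δ = n) (x : Fin n) : Fin n :=
  Fin.cast h (liftN (swap (Γ := Γ)) Δ (Fin.cast h.symm x))

/-- The braiding relation generalised to contexts `n = Γ' + Δ`, where `Γ'` is the target context of
the concurrent actions: `P = (swap + Δ)* R` if the original relation is that of free braids, and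
generalised bound braids otherwise. -/
def ActConc.GenBraiding : {Γ Γ₁ Γ₂ Γ' : ℕ} → {a : Act Γ Γ₁} → {a' : Act Γ Γ₂} → {r : Act Γ₁ Γ'} →
    {r' : Act Γ₂ Γ'} → ActConc a a' r r' → (Δ : ℕ) → {n : ℕ} → Γ' + Δ = n →
    Proc n → Proc n → Type
  | _, _, _, _, _, _, _, _, .cc _ _, _, _, _, P, R => BoundBraid P R
  | _, _, _, _, _, _, _, _, .bc _ _, _, _, _, P, R => BoundBraid P R
  | _, _, _, _, _, _, _, _, .cb _ _, _, _, _, P, R => BoundBraid P R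
  | _, _, _, _, _, _, _, _, .bb _ _, Δ, _, h, P, R => PLift (P = R.ren (swapN Δ h))
  | _, _, _, _, _, _, _, _, .ext _ _, _, _, _, P, R => BoundBraid P R
  | _, _, _, _, _, _, _, _, .nunu, _, _, _, P, R => BoundBraid P R

/-- The embedding of the original braiding relation into the generalised one. -/
def ActConc.embed : {Γ Γ₁ Γ₂ Γ' : ℕ} → {a : Act Γ Γ₁} → {a' : Act Γ Γ₂} → {r : Act Γ₁ Γ'} →
    {r' : Act Γ₂ Γ'} → (s : ActConc a a' r r') → {P R : Proc Γ'} → s.Braiding P R →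
    s.GenBraiding 0 rfl P R
  | _, _, _, _, _, _, _, _, .cc _ _, _, _, γ => .ofEq γ.down
  | _, _, _, _, _, _, _, _, .bc _ _, _, _, γ => .ofEq γ.down
  | _, _, _, _, _, _, _, _, .cb _ _, _, _, γ => .ofEq γ.down
  | _, _, _, _, _, _, _, _, .bb _ _, _, _, γ => ⟨γ.down⟩
  | _, _, _, _, _, _, _, _, .ext _ _, _, _, γ => .ofEq γ.down
  | _, _, _, _, _, _, _, _, .nunu, _, _, γ => BoundBraid₁.embed γ

theorem liftN_swap_invol {Γ : ℕ} (Δ : ℕ) :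
    liftN (swap (Γ := Γ)) Δ ∘ liftN swap Δ = id := by
  induction Δ with
  | zero => exact swap_swap
  | succ Δ ih => exact (lift_comp _ _).trans ((congrArg lift ih).trans lift_id)

theorem swapN_invol {Γ Δ n : ℕ} (h : Γ + 2 + Δ = n) : swapN Δ h ∘ swapN Δ h = id := by
  subst h; exact liftN_swap_invol Δ

theorem lift_swapN {Γ Δ n : ℕ} (h : Γ + 2 + Δ = n) (h' : Γ + 2 + (Δ + 1) = n + 1) :
    lift (swapN Δ h) = swapN (Δ + 1) h' := by
  subst h; rfl

theorem Act.size_eq {m Δ n n' : ℕ} (a : Act n n') (h : m + Δ = n) : m + (Δ + a.size) = n' := by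
  cases a <;> simp only [Act.size] <;> omega

/-- For `t : P —a→ R` and a braiding `γ` between `P` and `P'`: a process `R'`, an action `a/γ`,
the residual `t/γ : P' —(a/γ)→ R'` and the residual braiding `γ/t` between `R` and `R'`. -/
structure BraidSquare {Γ Γ₁ Γ₂ Γ' : ℕ} {b : Act Γ Γ₁} {b' : Act Γ Γ₂} {r : Act Γ₁ Γ'}
    {r' : Act Γ₂ Γ'} (s : ActConc b b' r r') (Δ : ℕ) {n n' : ℕ} (h : Γ' + Δ = n) (a : Act n n')
    (P' : Proc n) (R : Proc n') : Type where
  {act : Act n n'}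
  {R' : Proc n'}
  /-- `t/γ` -/
  trans : Trans P' act R'
  /-- `γ/t` -/
  braid : s.GenBraiding (Δ + a.size) (a.size_eq h) R R'

/-- The residuals `t/γ` and `γ/t` of a transition and a free braid. -/
def Trans.freeRes {Γ Δ n : ℕ} (h : Γ + 2 + Δ = n) : {n' : ℕ} → {P P' : Proc n} → {a : Act n n'} →
    {R : Proc n'} → Trans P a R → P = P'.ren (swapN Δ h) → (b b' : BAct Γ) →
    BraidSquare (.bb b b') Δ h a P' R
  | _, P, P', .b _, R, t, hP, b, b' =>
      { trans := (t.renB (swapN Δ h)).castB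
          (by rw [hP, Proc.ren_ren, swapN_invol, Proc.ren_id]) rfl rfl
        braid := ⟨by
          have e := lift_swapN h (by omega)
          show R = (R.ren (lift (swapN Δ h))).ren (swapN (Δ + 1) (by omega))
          rw [← e, Proc.ren_ren, lift_comp, swapN_invol, lift_id, Proc.ren_id]⟩ }
  | _, P, P', .c _, R, t, hP, b, b' =>
      { trans := (t.renC (swapN Δ h)).castC
          (by rw [hP, Proc.ren_ren, swapN_invol, Proc.ren_id]) rfl rfl
        braid := ⟨by
          show R = (R.ren (swapN Δ h)).ren (swapN Δ h)
          rw [Proc.ren_ren, swapN_invol, Proc.ren_id]⟩ }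

/-- The residuals `t/γ` and `γ/t` of a transition and a braiding. -/
def Trans.braidRes : {Γ Γ₁ Γ₂ Γ' : ℕ} → {b : Act Γ Γ₁} → {b' : Act Γ Γ₂} → {r : Act Γ₁ Γ'} →
    {r' : Act Γ₂ Γ'} → (s : ActConc b b' r r') → {Δ n n' : ℕ} → (h : Γ' + Δ = n) →
    {P P' : Proc n} → {a : Act n n'} → {R : Proc n'} → Trans P a R → s.GenBraiding Δ h P P' →
    BraidSquare s Δ h a P' R
  | _, _, _, _, _, _, _, _, .cc _ _, _, _, _, _, _, _, _, _, t, γ =>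
      ⟨(t.boundRes γ).trans, (t.boundRes γ).braid⟩
  | _, _, _, _, _, _, _, _, .bc _ _, _, _, _, _, _, _, _, _, t, γ =>
      ⟨(t.boundRes γ).trans, (t.boundRes γ).braid⟩
  | _, _, _, _, _, _, _, _, .cb _ _, _, _, _, _, _, _, _, _, t, γ =>
      ⟨(t.boundRes γ).trans, (t.boundRes γ).braid⟩
  | _, _, _, _, _, _, _, _, .bb b b', _, _, _, h, _, _, _, _, t, γ => t.freeRes h γ.down b b'
  | _, _, _, _, _, _, _, _, .ext _ _, _, _, _, _, _, _, _, _, t, γ =>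
      ⟨(t.boundRes γ).trans, (t.boundRes γ).braid⟩
  | _, _, _, _, _, _, _, _, .nunu, _, _, _, _, _, _, _, _, t, γ =>
      ⟨(t.boundRes γ).trans, (t.boundRes γ).braid⟩

/-! ### Traces and causal equivalence -/

/-- A trace from `P` to `R`: a finite sequence of composable transitions. -/
inductive Trace : {Γ Γ' : ℕ} → Proc Γ → Proc Γ' → Type
  | nil {Γ : ℕ} (P : Proc Γ) : Trace P P
  | cons {Γ Γ₁ Γ' : ℕ} {P : Proc Γ} {a : Act Γ Γ₁} {R : Proc Γ₁} {S : Proc Γ'}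
      (t : Trans P a R) (ts : Trace R S) : Trace P S

/-- `ts.depth Δ = Δ + |a₁| + … + |aₖ|`, where `a₁, …, aₖ` are the actions of the trace. -/
def Trace.depth : {Γ Γ' : ℕ} → {P : Proc Γ} → {R : Proc Γ'} → Trace P R → ℕ → ℕ
  | _, _, _, _, .nil _, Δ => Δ
  | _, _, _, _, .cons (a := a) _ ts, Δ => ts.depth (Δ + a.size)

theorem Trace.depth_eq {m n n' : ℕ} {P : Proc n} {R : Proc n'} (ts : Trace P R) {Δ : ℕ}
    (h : m + Δ = n) : m + ts.depth Δ = n' := by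
  induction ts generalizing Δ with
  | nil P => exact h
  | cons t ts ih => exact ih (Act.size_eq _ h)

/-- For a trace `ts` from `P` to `S` and a braiding `γ` between `P` and `P'`: a process `S'`, the
residual trace `ts/γ` from `P'` to `S'` and the residual braiding `γ/ts` between `S` and `S'`. -/
structure BraidStrip {Γ Γ₁ Γ₂ Γ' : ℕ} {b : Act Γ Γ₁} {b' : Act Γ Γ₂} {r : Act Γ₁ Γ'}
    {r' : Act Γ₂ Γ'} (s : ActConc b b' r r') {Δ n n' : ℕ} (h : Γ' + Δ = n) {P : Proc n}
    {S : Proc n'} (ts : Trace P S) (P' : Proc n) : Type where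
  {S' : Proc n'}
  /-- `ts/γ` -/
  trace : Trace P' S'
  /-- `γ/ts` -/
  braid : s.GenBraiding (ts.depth Δ) (ts.depth_eq h) S S'

/-- The residuals `ts/γ` and `γ/ts` of a trace and a braiding. -/
def Trace.braidRes {Γ Γ₁ Γ₂ Γ' : ℕ} {b : Act Γ Γ₁} {b' : Act Γ Γ₂} {r : Act Γ₁ Γ'}
    {r' : Act Γ₂ Γ'} (s : ActConc b b' r r') : {Δ n n' : ℕ} → (h : Γ' + Δ = n) → {P P' : Proc n} →
    {S : Proc n'} → (ts : Trace P S) → s.GenBraiding Δ h P P' → BraidStrip s h ts P'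
  | _, _, _, _, _, P', _, .nil _, γ => ⟨.nil P', γ⟩
  | _, _, _, h, _, _, _, .cons t ts, γ =>
      let q := t.braidRes s h γ
      let v := ts.braidRes s _ q.braid
      ⟨.cons q.trans v.trace, v.braid⟩

/-- The residual `t'/t` of concurrent transitions. -/
def Conc.upper {Γ Γ₁ Γ₂ Γ' : ℕ} {a : Act Γ Γ₁} {a' : Act Γ Γ₂} {r : Act Γ₁ Γ'}
    {r' : Act Γ₂ Γ'} {P : Proc Γ} {R : Proc Γ₁} {R' : Proc Γ₂} {s : ActConc a a' r r'}
    {t : Trans P a R} {t' : Trans P a' R'} (d : Conc s t t') : Trans R r d.pentagon.Q :=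
  d.pentagon.upper

/-- The residual `t/t'` of concurrent transitions. -/
def Conc.lower {Γ Γ₁ Γ₂ Γ' : ℕ} {a : Act Γ Γ₁} {a' : Act Γ Γ₂} {r : Act Γ₁ Γ'}
    {r' : Act Γ₂ Γ'} {P : Proc Γ} {R : Proc Γ₁} {R' : Proc Γ₂} {s : ActConc a a' r r'}
    {t : Trans P a R} {t' : Trans P a' R'} (d : Conc s t t') : Trans R' r' d.pentagon.Q' :=
  d.pentagon.lower

/-- The braiding between the targets of `t'/t` and `t/t'`, transported through a continuation `ts`
of `t'/t`. -/
def Conc.transport {Γ Γ₁ Γ₂ Γ' n : ℕ} {a : Act Γ Γ₁} {a' : Act Γ Γ₂} {r : Act Γ₁ Γ'}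
    {r' : Act Γ₂ Γ'} {P : Proc Γ} {R : Proc Γ₁} {R' : Proc Γ₂} {s : ActConc a a' r r'}
    {t : Trans P a R} {t' : Trans P a' R'} (d : Conc s t t') {S : Proc n}
    (ts : Trace d.pentagon.Q S) : BraidStrip s (Δ := 0) rfl ts d.pentagon.Q' :=
  ts.braidRes s rfl (s.embed d.pentagon.γ)

/-- Causal equivalence `α : ts ≃ us` of coinitial traces. -/
inductive CausalEq : {Γ Γ' : ℕ} → {P : Proc Γ} → {R R' : Proc Γ'} → Trace P R → Trace P R' → Type
  | nil {Γ : ℕ} (P : Proc Γ) : CausalEq (.nil P) (.nil P)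
  | cons {Γ Γ₁ Γ' : ℕ} {P : Proc Γ} {a : Act Γ Γ₁} {Q : Proc Γ₁} {R R' : Proc Γ'}
      (t : Trans P a Q) {ts : Trace Q R} {us : Trace Q R'} (α : CausalEq ts us) :
      CausalEq (.cons t ts) (.cons t us)
  | swap {Γ Γ₁ Γ₂ Γ' n : ℕ} {a : Act Γ Γ₁} {a' : Act Γ Γ₂} {r : Act Γ₁ Γ'} {r' : Act Γ₂ Γ'}
      {P : Proc Γ} {R : Proc Γ₁} {R' : Proc Γ₂} {s : ActConc a a' r r'} {t : Trans P a R}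
      {t' : Trans P a' R'} (d : Conc s t t') {S : Proc n} (ts : Trace d.pentagon.Q S) :
      CausalEq (.cons t (.cons d.upper ts)) (.cons t' (.cons d.lower (d.transport ts).trace))
  | trans {Γ Γ' : ℕ} {P : Proc Γ} {R₁ R₂ R₃ : Proc Γ'} {ts : Trace P R₁} {ts' : Trace P R₂}
      {us : Trace P R₃} (α : CausalEq ts' us) (β : CausalEq ts ts') : CausalEq ts us

/-- Composite braidings: the relation between processes determined by a causal equivalence. -/
inductive CompBraiding : {Γ Γ' : ℕ} → {P : Proc Γ} → {R R' : Proc Γ'} → {ts : Trace P R} →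
    {us : Trace P R'} → CausalEq ts us → Proc Γ' → Proc Γ' → Type
  | nil {Γ : ℕ} (P : Proc Γ) : CompBraiding (.nil P) P P
  | swap {Γ Γ₁ Γ₂ Γ' n : ℕ} {a : Act Γ Γ₁} {a' : Act Γ Γ₂} {r : Act Γ₁ Γ'} {r' : Act Γ₂ Γ'}
      {P : Proc Γ} {R : Proc Γ₁} {R' : Proc Γ₂} {s : ActConc a a' r r'} {t : Trans P a R}
      {t' : Trans P a' R'} (d : Conc s t t') {S : Proc n} (ts : Trace d.pentagon.Q S)
      (γ : s.GenBraiding (ts.depth 0) (ts.depth_eq rfl) S (d.transport ts).S')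
      (hγ : γ = (d.transport ts).braid) :
      CompBraiding (.swap d ts) S (d.transport ts).S'
  | cons {Γ Γ₁ Γ' : ℕ} {P : Proc Γ} {a : Act Γ Γ₁} {Q : Proc Γ₁} {R R' : Proc Γ'}
      (t : Trans P a Q) {ts : Trace Q R} {us : Trace Q R'} {α : CausalEq ts us} {S S' : Proc Γ'}
      (γ : CompBraiding α S S') : CompBraiding (.cons t α) S S'
  | trans {Γ Γ' : ℕ} {P : Proc Γ} {R₁ R₂ R₃ : Proc Γ'} {ts : Trace P R₁} {ts' : Trace P R₂}
      {us : Trace P R₃} {α : CausalEq ts' us} {β : CausalEq ts ts'} {S₁ S₂ S₃ : Proc Γ'}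
      (γ : CompBraiding β S₁ S₂) (δ : CompBraiding α S₂ S₃) : CompBraiding (.trans α β) S₁ S₃

end PiCalculus

namespace PiCalculus

/-! Composite braidings mirror causal equivalences rule by rule: the family `CompBraiding` has
exactly one constructor over each constructor of `CausalEq`. A composite braiding over `α` therefore
has the shape of the derivation `α`, and only two choices could remain in building one: the braiding
supplied at a transposition `[t,t'], ts`, and the intermediate process at a composition `α ∘ β`. The
proof shows that both are forced.

At a transposition the choice is removed by the equation `hγ`, which identifies the supplied
braiding with the transported one, `(d.transport ts).braid`. This equation is essential, since
generalised bound braids are data and need not be unique between given processes: a choice is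
related to itself both by reflexivity on the left summand and by reflexivity on the right. The
endpoints agree as well, because the right-hand trace of the transposition is defined as the
residual of `ts` by the same braiding and so ends at the process that the transported braiding
reaches.

At a composition the intermediate process is a priori arbitrary. It is pinned down by proving more
than uniqueness between the two targets: any composite braiding over `α`, between any two processes,
already relates the targets of the two traces of `α`. Hence the intermediate process must be the
target of the intermediate trace, which is part of the data of `α ∘ β`.

Existence is `CausalEq.braiding`, a recursion on `α`; the rigidity of endpoints and uniqueness are
proved together in `CompBraiding.eq_braiding`. The pi-calculus enters only through the residuals:
the work on swaps, pops and the hexagon is done where pentagons and braid squares are constructed,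
and here they are used as given. -/

/-- The canonical composite braiding `γ_α` between the targets of causally equivalent traces. -/
def CausalEq.braiding : {Γ Γ' : ℕ} → {P : Proc Γ} → {R R' : Proc Γ'} → {ts : Trace P R} →
    {us : Trace P R'} → (α : CausalEq ts us) → CompBraiding α R R'
  | _, _, _, _, _, _, _, .nil P => .nil P
  | _, _, _, _, _, _, _, .cons t α => .cons t α.braiding
  | _, _, _, _, _, _, _, .swap d ts => .swap d ts _ rfl
  -- The order is reversed: `α` follows `β` in the composite, while composite braidings are listed
  -- from source to target. The two meet at the target of the intermediate trace.
  | _, _, _, _, _, _, _, .trans α β => .trans β.braiding α.braiding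

/-- A composite braiding determined by `α : ts ≃ us` relates the targets of `ts` and `us`, and it
is the canonical one. -/
theorem CompBraiding.eq_braiding {Γ Γ' : ℕ} {P : Proc Γ} {R R' : Proc Γ'} {ts : Trace P R}
    {us : Trace P R'} {α : CausalEq ts us} {S S' : Proc Γ'} (γ : CompBraiding α S S') :
    -- The endpoints `S`, `S'` are independent of the targets `R`, `R'`, as the composition case
    -- requires. Until they are identified, `γ` and `α.braiding` have different types, hence the
    -- heterogeneous equality.
    S = R ∧ S' = R' ∧ γ ≍ α.braiding := by
  -- Induction on the braiding rather than on `α`: every index of `γ` is a variable, so no inversion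
  -- is needed against an index such as `(d.transport ts).S'`, which is not in constructor form.
  induction γ with
  | nil P => exact ⟨rfl, rfl, HEq.rfl⟩
  | swap d ts γ hγ =>
    -- The only place where the braiding itself, and not just its endpoints, has to be identified:
    -- eliminating the equation replaces the supplied braiding by the transported one, which is the
    -- value chosen by `CausalEq.braiding`.
    subst hγ
    exact ⟨rfl, rfl, HEq.rfl⟩
  | cons t γ ih =>
    -- Identifying the endpoints gives both sides of `h` the same type, so that it becomes an
    -- ordinary equation and the premise can be replaced by the canonical braiding of the tail.
    obtain ⟨rfl, rfl, h⟩ := ih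
    obtain rfl := eq_of_heq h
    exact ⟨rfl, rfl, HEq.rfl⟩
  | trans γ δ ihγ ihδ =>
    -- The second equation is the decisive one: the arbitrary intermediate process `S₂` is the
    -- target `R₂` of the intermediate trace.
    obtain ⟨rfl, rfl, h⟩ := ihγ
    -- The second premise also forces `S₂ = R₂`. After the previous substitution this is a trivial
    -- identity and is dropped; there is no conflict between the two premises because both refer to
    -- the same intermediate trace.
    obtain ⟨-, rfl, h'⟩ := ihδ
    obtain rfl := eq_of_heq h
    obtain rfl := eq_of_heq h'
    -- Both premises are now canonical, and their composition is by definition the canonical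
    -- braiding of `α ∘ β`.
    exact ⟨rfl, rfl, HEq.rfl⟩

end PiCalculus

theorem mainTheorem5 {Γ Γ' : ℕ} {P : PiCalculus.Proc Γ} {R R' : PiCalculus.Proc Γ'}
    {ts : PiCalculus.Trace P R} {us : PiCalculus.Trace P R'} (α : PiCalculus.CausalEq ts us) :
    ∃ γ : PiCalculus.CompBraiding α R R', ∀ γ' : PiCalculus.CompBraiding α R R', γ' = γ :=
  -- With the endpoints specialised to `R` and `R'`, the two endpoint equations carry no
  -- information, and the heterogeneous equality is between terms of one type.
  ⟨α.braiding, fun γ' => eq_of_heq γ'.eq_braiding.2.2⟩
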